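/- Consider three points $z_i=(x_i^\mu,\theta_i^\alpha,\bar\theta_i^{\dot\alpha})$, $i=1,2,3$, of four-dimensional $\mathcal N=1$ superspace, with metric $(+,-,-,-)$ and $\sigma^\mu=(1,\vec\sigma)$. Let $$D_i=\frac{\partial}{\partial\theta_i}-\mathrm i\,\sigma^\mu\bar\theta_i\,\frac{\partial}{\partial x_i^\mu},\qquad \bar D_i=-\frac{\partial}{\partial\bar\theta_i}+\mathrm i\,\theta_i\sigma^\mu\,\frac{\partial}{\partial x_i^\mu}$$ be the covariant derivatives (left derivatives in the odd variables), $x_{i\pm}^\mu=x_i^\mu\mp\mathrm i\,\theta_i\sigma^\mu\bar\theta_i$, and $$x_{\bar ij}^\mu=x_{i-}^\mu-x_{j+}^\mu-2\mathrm i\,\theta_j\sigma^\mu\bar\theta_i .$$ Superfields are functions of the $x_i$ with values in the complex Grassmann algebra on the twelve variables $\theta_i^\alpha,\bar\theta_i^{\dot\alpha}$. Let $$J_1=\frac{X_{1+}^2}{X_{1-}^2},\qquad X_{1+}^2=\frac{x_{\bar23}^2}{x_{\bar21}^2x_{\bar13}^2},\qquad X_{1-}^2=\frac{x_{\bar32}^2}{x_{\bar31}^2x_{\bar12}^2},\qquad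 I_{3PF}=J_1-1,$$ where $I_{3PF}$ is the nilpotent three-point invariant. Let $\eta_i,\kappa_i\in\mathbb R$ (scale dimensions and R-charges) with $\kappa_1+\kappa_2+\kappa_3=0$, and put $$\Delta_{lm}=-\tfrac14\sum_{i=1}^3\eta_i+\tfrac12(\eta_l+\eta_m)+\tfrac12(\kappa_l-\kappa_m).$$ Let $U\subset(\mathbb R^4)^3$ be non-empty and open, with all $(x_i-x_j)^2\neq0$ ($i\ne j$) on $U$, and fix on $U$ continuous branches, symmetric in $i,j$, of $\log (x_i-x_j)^2$. Complex powers of the even superfields $x_{\bar ij}^2$ are defined with these branches by Taylor expansion in the nilpotent part, and powers of $I_{3PF}+1$ by the binomial series. Let $f_{3PF}$ be an arbitrary function of one variable, given by its Taylor series at $0$ with complex coefficients, and let $$G=\frac{f_{3PF}(I_{3PF})}{\prod_{l\neq m}(x_{\bar lm}^2)^{\Delta_{lm}}}$$ be the general scalar three-point function. 1. If the charges are those of one anti-chiral and two chiral scalar superfields, $\kappa_1=\tfrac13\eta_1$, $\kappa_2=-\tfrac13\eta_2$, $\kappa_3=-\tfrac13\eta_3$, then $\eta_1=\eta_2+\eta_3$.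 2. $G$ satisfies the chirality constraints $D_1G=0$, $\bar D_2G=0$, $\bar D_3G=0$ on $U$ if and only if there is a constant $C\in\mathbb C$ such that on $U$ $$f_{3PF}(I_{3PF})=C\,(I_{3PF}+1)^{-\Delta_{21}}\qquad\text{and}\qquad G=\frac{C}{(x_{\bar12}^2)^{\eta_2}\,(x_{\bar13}^2)^{\eta_3}},$$ and such that, if $C\neq0$, then $\kappa_1=\tfrac13\eta_1$, $\kappa_2=-\tfrac13\eta_2$, $\kappa_3=-\tfrac13\eta_3$ (hence, by 1, $\eta_1=\eta_2+\eta_3$). -/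

import Mathlib

noncomputable section

namespace ThreePointSCFT

/-! ## The Grassmann algebra of three copies of N = 1 superspace -/

/-- Labels of the twelve Grassmann coordinates of three points in superspace: `inl (i, a)` labels
the component `a` of `θ_i`, and `inr (i, b)` labels the component `b` of `θbar_i`.
The points `1, 2, 3` are indexed by `0, 1, 2 : Fin 3`. -/
abbrev Gen : Type := (Fin 3 × Fin 2) ⊕ (Fin 3 × Fin 2)

/-- The complex Grassmann algebra on the twelve odd coordinates. -/
abbrev Grassmann : Type := ExteriorAlgebra ℂ (Gen → ℂ)

/-- The monomial basis of the Grassmann algebra, for some ordering of the twelve generators. -/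
def monomialBasis : Module.Basis (Finset (Fin (Fintype.card Gen))) ℂ Grassmann :=
  Module.Basis.ExteriorAlgebra ((Pi.basisFun ℂ Gen).reindex (Fintype.equivFin Gen))

/-- The Grassmann algebra is finite-dimensional; it is normed through its coordinates. The norm
serves only to differentiate with respect to the real coordinates, so its choice is immaterial. -/
instance : NormedAddCommGroup Grassmann :=
  NormedAddCommGroup.induced Grassmann (Finset (Fin (Fintype.card Gen)) → ℂ)
    monomialBasis.equivFun monomialBasis.equivFun.injective

instance : NormedSpace ℂ Grassmann :=
  NormedSpace.induced ℂ Grassmann (Finset (Fin (Fintype.card Gen)) → ℂ) monomialBasis.equivFun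

/-- The odd coordinate `θ_i^a`. -/
def θ (i : Fin 3) (a : Fin 2) : Grassmann := ExteriorAlgebra.ι ℂ (Pi.single (Sum.inl (i, a)) 1)

/-- The odd coordinate `θbar_i^b`. -/
def θbar (i : Fin 3) (b : Fin 2) : Grassmann :=
  ExteriorAlgebra.ι ℂ (Pi.single (Sum.inr (i, b)) 1)

/-- The left derivative of the Grassmann algebra with respect to an odd coordinate: the
antiderivation that maps this coordinate to `1` and the other ones to `0`. -/
def oddDeriv (g : Gen) : Grassmann →ₗ[ℂ] Grassmann :=
  CliffordAlgebra.contractLeft (LinearMap.proj g : Module.Dual ℂ (Gen → ℂ))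

/-- The value `f(N) = ∑ k, f_k N ^ k` of a function `f` with Taylor series `∑ k, f_k X ^ k` at `0`
on an element `N` without constant term. The powers of such an `N` beyond the number of odd
coordinates vanish, so the sum is the whole Taylor series. -/
def taylorEval (f : PowerSeries ℂ) (N : Grassmann) : Grassmann :=
  ∑ k ∈ Finset.range (Fintype.card Gen + 1), PowerSeries.coeff k f • N ^ k

/-- The complex power `Φ ^ a` of an even element whose constant term is `exp L`, with respect to
the value `L` of the logarithm of the constant term:
`exp (a L) * ∑ k, (a choose k) (exp (-L) Φ - 1) ^ k`. -/
def gpow (L a : ℂ) (Φ : Grassmann) : Grassmann :=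
  Complex.exp (a * L) •
    taylorEval (PowerSeries.binomialSeries ℂ a) (Complex.exp (-L) • Φ - 1)

/-! ## Superfields, covariant derivatives and intervals -/

/-- The real coordinates `x_i^μ` of three points. -/
abbrev Config : Type := Fin 3 → Fin 4 → ℝ

/-- Functions of three points of superspace, through their expansion in the odd coordinates. -/
abbrev Superfield : Type := Config → Grassmann

/-- The Pauli matrices `σ^μ = (1, σ₁, σ₂, σ₃)`. -/
def pauli : Fin 4 → Matrix (Fin 2) (Fin 2) ℂ :=
  ![!![1, 0; 0, 1], !![0, 1; 1, 0], !![0, -Complex.I; Complex.I, 0], !![1, 0; 0, -1]]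

/-- The diagonal of the Minkowski metric, of signature `(+, -, -, -)`. -/
def minkowski : Fin 4 → ℂ := ![1, -1, -1, -1]

/-- The bilinear `θ_j σ^μ θbar_i`. -/
def bilin (j i : Fin 3) (μ : Fin 4) : Grassmann :=
  ∑ a, ∑ b, pauli μ a b • (θ j a * θbar i b)

/-- The derivative `∂/∂x_i^μ`. -/
def evenDeriv (i : Fin 3) (μ : Fin 4) (Φ : Superfield) : Superfield := fun x =>
  fderiv ℝ Φ x (Pi.single i (Pi.single μ 1))

/-- The covariant derivative `D = ∂/∂θ - i σ^μ θbar ∂/∂x^μ` at the point `i`. -/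
def covD (i : Fin 3) (a : Fin 2) (Φ : Superfield) : Superfield := fun x =>
  oddDeriv (Sum.inl (i, a)) (Φ x) -
    Complex.I • ∑ μ, ∑ b, pauli μ a b • (θbar i b * evenDeriv i μ Φ x)

/-- The covariant derivative `Dbar = -∂/∂θbar + i θ σ^μ ∂/∂x^μ` at the point `i`. -/
def covDbar (i : Fin 3) (b : Fin 2) (Φ : Superfield) : Superfield := fun x =>
  -oddDeriv (Sum.inr (i, b)) (Φ x) +
    Complex.I • ∑ μ, ∑ a, pauli μ a b • (θ i a * evenDeriv i μ Φ x)

/-- The chiral coordinate `x_{i+} = x_i - i θ_i σ θbar_i`. -/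
def xPlus (i : Fin 3) (μ : Fin 4) : Superfield := fun x =>
  algebraMap ℂ Grassmann (x i μ : ℂ) - Complex.I • bilin i i μ

/-- The anti-chiral coordinate `x_{i-} = x_i + i θ_i σ θbar_i`. -/
def xMinus (i : Fin 3) (μ : Fin 4) : Superfield := fun x =>
  algebraMap ℂ Grassmann (x i μ : ℂ) + Complex.I • bilin i i μ

/-- The interval `x_{ībar j} = x_{i-} - x_{j+} - 2 i θ_j σ θbar_i`. -/
def interval (i j : Fin 3) (μ : Fin 4) : Superfield := fun x =>
  xMinus i μ x - xPlus j μ x - (2 * Complex.I) • bilin j i μ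

/-- The Minkowski square `(x_{ībar j})²` of the interval. -/
def intervalSq (i j : Fin 3) : Superfield := fun x =>
  ∑ μ, minkowski μ • (interval i j μ x * interval i j μ x)

/-- The Minkowski square `(x_i - x_j)²` for vanishing odd coordinates. -/
def bodySq (i j : Fin 3) (x : Config) : ℂ :=
  ∑ μ, minkowski μ * ((x i μ - x j μ : ℝ) : ℂ) ^ 2

/-! ## The three-point invariant and the three-point function -/

/-- `X_{1+}² = x_{2bar 3}² / (x_{2bar 1}² x_{1bar 3}²)`. -/
def X1PlusSq : Superfield := fun x =>
  intervalSq 1 2 x * Ring.inverse (intervalSq 1 0 x * intervalSq 0 2 x)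

/-- `X_{1-}² = x_{3bar 2}² / (x_{3bar 1}² x_{1bar 2}²)`. -/
def X1MinusSq : Superfield := fun x =>
  intervalSq 2 1 x * Ring.inverse (intervalSq 2 0 x * intervalSq 0 1 x)

/-- `J_1 = X_{1+}² / X_{1-}²`. -/
def J1 : Superfield := fun x => X1PlusSq x * Ring.inverse (X1MinusSq x)

/-- The nilpotent three-point invariant `I_{3PF} = J_1 - 1`. -/
def I3PF : Superfield := fun x => J1 x - 1

/-- A choice, on the set `U` of configurations, of the logarithms of the three squares
`(x_i - x_j)²` (so that none of them vanishes on `U`), continuous and symmetric in `i, j`.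
It fixes the branch of the powers. -/
structure IsLogBranch (U : Set Config) (ℓ : Fin 3 → Fin 3 → Config → ℂ) : Prop where
  continuousOn : ∀ i j, i ≠ j → ContinuousOn (ℓ i j) U
  symm : ∀ i j, i ≠ j → ∀ x ∈ U, ℓ i j x = ℓ j i x
  exp_eq : ∀ i j, i ≠ j → ∀ x ∈ U, Complex.exp (ℓ i j x) = bodySq i j x

/-- The power `(x_{ībar j}²) ^ a`. -/
def intervalPow (ℓ : Fin 3 → Fin 3 → Config → ℂ) (i j : Fin 3) (a : ℂ) : Superfield := fun x =>
  gpow (ℓ i j x) a (intervalSq i j x)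

/-- The exponent `Δ_{lm}` of the `3`-point function of scalar superfields with scale dimensions
`η_i` and R-charges `κ_i`. -/
def Δ (η κ : Fin 3 → ℝ) (l m : Fin 3) : ℝ :=
  -(1 / 4) * ∑ i, η i + (1 / 2) * (η l + η m) + (1 / 2) * (κ l - κ m)

/-- The general scalar three-point function `f(I_{3PF}) / ∏_{l ≠ m} (x_{lbar m}²) ^ Δ_{lm}`. -/
def generalThreePoint (ℓ : Fin 3 → Fin 3 → Config → ℂ) (η κ : Fin 3 → ℝ) (f : PowerSeries ℂ) :
    Superfield := fun x =>
  taylorEval f (I3PF x) * Ring.inverse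
    (intervalPow ℓ 0 1 (Δ η κ 0 1) x * intervalPow ℓ 1 0 (Δ η κ 1 0) x *
     intervalPow ℓ 0 2 (Δ η κ 0 2) x * intervalPow ℓ 2 0 (Δ η κ 2 0) x *
     intervalPow ℓ 1 2 (Δ η κ 1 2) x * intervalPow ℓ 2 1 (Δ η κ 2 1) x)

/-- The function `1 / ((x_{1bar 2}²) ^ η₂ (x_{1bar 3}²) ^ η₃)`. -/
def chiralThreePoint (ℓ : Fin 3 → Fin 3 → Config → ℂ) (η : Fin 3 → ℝ) : Superfield := fun x =>
  Ring.inverse (intervalPow ℓ 0 1 (η 1) x * intervalPow ℓ 0 2 (η 2) x)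

/-- The chirality constraints on `U` for an anti-chiral field at the first point and chiral
fields at the second and the third point. -/
def IsChiralOn (U : Set Config) (G : Superfield) : Prop :=
  ∀ x ∈ U, ∀ s : Fin 2, covD 0 s G x = 0 ∧ covDbar 1 s G x = 0 ∧ covDbar 2 s G x = 0

/-- The relation `κ = ± η / 3` between R-charge and scale dimension, with `+` for the anti-chiral
field and `-` for the two chiral fields. -/
def ChiralCharges (η κ : Fin 3 → ℝ) : Prop :=
  κ 0 = η 0 / 3 ∧ κ 1 = -(η 1 / 3) ∧ κ 2 = -(η 2 / 3)

end ThreePointSCFT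

end
/-!
The points are numbered from `0`.

The squares `x_{ībar j}²` lie in the commutative even part of the Grassmann algebra, where complex
powers obey the usual power laws: both sides are polynomial in the exponents, and the laws hold at
natural exponents. Hence `J₁` is a monomial in the `x_{ībar j}²` with exponents `±1`, and `G` is a
series in `J₁ - 1` times a monomial.

In matrix notation `x_{ībar j} = x_{ībar 0} - x_{jbar 0} - 4i (θ_j - θ_0) (θbar_i - θbar_0)`. Modulo
the left ideal generated by the two components of the spinor
`x_{1bar0}⁻¹ (θbar_1 - θbar_0) - x_{2bar0}⁻¹ (θbar_2 - θbar_0)` the two triple products of squares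
agree, so `(J₁ - 1)³ = 0` and only the coefficients `f₀, f₁, f₂` of the series matter.

For necessity, the odd coordinates are specialized so that each constraint says that a single odd
derivative of an explicit polynomial vanishes. Then `D₀ G = 0` gives
`f₁ = -Δ₁₀ f₀ = Δ₂₀ f₀` and `2 f₂ = (-Δ₁₀ - 1) f₁`, so that `f` agrees with `f₀ (1 + X) ^ (-Δ₁₀)` up
to order `2`, while `Dbar₁ G = Dbar₂ G = 0` give `Δ₁₂ f₀ = f₁ = -Δ₂₁ f₀`; for `f₀ ≠ 0` these
relations force the charges.

For sufficiency, `D₀`, `Dbar₁` and `Dbar₂` act as derivations on even superfields and annihilate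
`x_{0bar 1}` and `x_{0bar 2}`, hence all powers of their squares.
-/

noncomputable section

namespace ThreePointSCFT

section TruncatedSeries

variable {R A B : Type*} [CommRing R] [Ring A] [Algebra R A] [Ring B] [Algebra R B]

/-- The Taylor series `f` at `N`, truncated before degree `n`: the value of `f` at `N` whenever
`N ^ n = 0`. It extends `taylorEval` to arbitrary algebras. -/
def truncEval (n : ℕ) (f : PowerSeries R) (N : A) : A :=
  Polynomial.aeval N (f.trunc n)

lemma truncEval_eq_sum (n : ℕ) (f : PowerSeries R) (N : A) :
    truncEval n f N = ∑ k ∈ Finset.range n, f.coeff k • N ^ k := by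
  rw [truncEval, Polynomial.aeval_def, PowerSeries.eval₂_trunc_eq_sum_range]
  simp only [Algebra.smul_def]

lemma map_truncEval (φ : A →ₐ[R] B) (n : ℕ) (f : PowerSeries R) (N : A) :
    φ (truncEval n f N) = truncEval n f (φ N) :=
  (Polynomial.aeval_algHom_apply φ N (f.trunc n)).symm

lemma truncEval_of_le {m n : ℕ} (hmn : m ≤ n) {N : A} (hN : N ^ m = 0) (f : PowerSeries R) :
    truncEval n f N = truncEval m f N := by
  rw [truncEval_eq_sum, truncEval_eq_sum]
  refine (Finset.sum_subset (Finset.range_subset_range.2 hmn) fun k _ hk => ?_).symm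
  rw [pow_eq_zero_of_le (by simpa using hk) hN, smul_zero]

end TruncatedSeries

section CommutativeTruncatedSeries

variable {R A : Type*} [CommRing R] [CommRing A] [Algebra R A]

lemma truncEval_coe {N : A} {n : ℕ} (hN : N ^ n = 0) (p : Polynomial R) :
    truncEval n (p : PowerSeries R) N = Polynomial.aeval N p := by
  rw [Polynomial.aeval_eq_sum_range' (n := max n (p.natDegree + 1)) (by simp),
    ← truncEval_of_le (le_max_left n (p.natDegree + 1)) hN, truncEval_eq_sum]
  simp only [Polynomial.coeff_coe]

lemma truncEval_mul {N : A} {n : ℕ} (hN : N ^ n = 0) (f g : PowerSeries R) :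
    truncEval n (f * g) N = truncEval n f N * truncEval n g N := by
  rw [truncEval, ← PowerSeries.trunc_trunc_mul_trunc, ← Polynomial.coe_mul]
  exact (truncEval_coe hN _).trans (map_mul _ _ _)

lemma truncEval_sub_constantCoeff_mem {I : Ideal A} {N : A} (hN : N ∈ I) {n : ℕ} (hn : n ≠ 0)
    (f : PowerSeries R) :
    truncEval n f N - algebraMap R A f.constantCoeff ∈ I := by
  obtain ⟨m, rfl⟩ := Nat.exists_eq_succ_of_ne_zero hn
  rw [truncEval_eq_sum, Finset.sum_range_succ', pow_zero, PowerSeries.coeff_zero_eq_constantCoeff,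
    ← Algebra.algebraMap_eq_smul_one, add_sub_cancel_right]
  exact I.sum_mem fun k _ => I.smul_of_tower_mem _ (I.pow_mem_of_mem hN _ k.succ_pos)

end CommutativeTruncatedSeries

section PolynomialFamilies

variable {K A : Type*} [Field K] [CommRing A] [Algebra K A]

/-- An algebra-valued function of a scalar parameter given by a polynomial. Such a function is
determined by its values at the natural numbers, which is how identities between integer powers
extend to complex powers. -/
def IsPolynomialFamily (F : K → A) : Prop :=
  ∃ P : Polynomial A, ∀ a, F a = P.eval (algebraMap K A a)

namespace IsPolynomialFamily

variable {F G : K → A}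

lemma mul (hF : IsPolynomialFamily F) (hG : IsPolynomialFamily G) :
    IsPolynomialFamily fun a => F a * G a := by
  obtain ⟨P, hP⟩ := hF
  obtain ⟨Q, hQ⟩ := hG
  exact ⟨P * Q, fun a => by simp only [hP, hQ, Polynomial.eval_mul]⟩

lemma sub (hF : IsPolynomialFamily F) (hG : IsPolynomialFamily G) :
    IsPolynomialFamily fun a => F a - G a := by
  obtain ⟨P, hP⟩ := hF
  obtain ⟨Q, hQ⟩ := hG
  exact ⟨P - Q, fun a => by simp only [hP, hQ, Polynomial.eval_sub]⟩

lemma comp_mul_const (hF : IsPolynomialFamily F) (b : K) :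
    IsPolynomialFamily fun a => F (a * b) := by
  obtain ⟨P, hP⟩ := hF
  exact ⟨P.comp (Polynomial.X * Polynomial.C (algebraMap K A b)), fun a => by
    simp only [hP, map_mul, Polynomial.eval_comp, Polynomial.eval_mul, Polynomial.eval_X,
      Polynomial.eval_C]⟩

lemma exists_eval_eq_dual (hF : IsPolynomialFamily F) (φ : Module.Dual K A) :
    ∃ q : Polynomial K, ∀ a, q.eval a = φ (F a) := by
  obtain ⟨P, hP⟩ := hF
  refine ⟨∑ k ∈ P.support, Polynomial.monomial k (φ (P.coeff k)), fun a => ?_⟩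
  rw [hP, Polynomial.eval_finsetSum, Polynomial.eval_eq_sum, Polynomial.sum, map_sum]
  refine Finset.sum_congr rfl fun k _ => ?_
  rw [Polynomial.eval_monomial, ← map_pow, ← Algebra.commutes, ← Algebra.smul_def, map_smul,
    smul_eq_mul, mul_comm]

lemma ext [CharZero K] (hF : IsPolynomialFamily F) (hG : IsPolynomialFamily G)
    (h : ∀ n : ℕ, F n = G n) (a : K) : F a = G a := by
  rw [← sub_eq_zero, ← Module.forall_dual_apply_eq_zero_iff K]
  intro φ
  obtain ⟨q, hq⟩ := (hF.sub hG).exists_eval_eq_dual φ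
  have hq0 : q = 0 := Polynomial.eq_zero_of_infinite_isRoot q
    ((Set.infinite_range_of_injective (Nat.cast_injective (R := K))).mono <| by
      rintro _ ⟨n, rfl⟩
      simp [hq, h])
  rw [← hq a, hq0, Polynomial.eval_zero]

end IsPolynomialFamily

end PolynomialFamilies

section ComplexPowers

variable {A B : Type*} [Ring A] [Algebra ℂ A] [Ring B] [Algebra ℂ B]

/-- The power `(1 + N) ^ a` of an element with `N ^ n = 0`, through the binomial series. -/
def binomialPow (n : ℕ) (a : ℂ) (N : A) : A :=
  truncEval n (PowerSeries.binomialSeries ℂ a) N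

/-- The power `Φ ^ a` of an element equal to `exp L` up to a nilpotent element of order `n`, for
the value `L` of its logarithm. It extends `gpow` to arbitrary algebras. -/
def complexPow (n : ℕ) (L a : ℂ) (Φ : A) : A :=
  Complex.exp (a * L) • binomialPow n a (Complex.exp (-L) • Φ - 1)

lemma map_complexPow (φ : A →ₐ[ℂ] B) (n : ℕ) (L a : ℂ) (Φ : A) :
    φ (complexPow n L a Φ) = complexPow n L a (φ Φ) := by
  simp only [complexPow, binomialPow, map_smul, map_truncEval, map_sub, map_one]

end ComplexPowers

section CommutativeComplexPowers

variable {A : Type*} [CommRing A] [Algebra ℂ A]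

lemma isPolynomialFamily_binomialPow (n : ℕ) (N : A) :
    IsPolynomialFamily fun a => binomialPow n a N := by
  refine ⟨∑ k ∈ Finset.range n, Polynomial.C ((k.factorial : ℂ)⁻¹ • N ^ k) *
    (descPochhammer ℤ k).map (Int.castRingHom A), fun a => ?_⟩
  simp only [binomialPow]
  rw [truncEval_eq_sum, Polynomial.eval_finsetSum]
  refine Finset.sum_congr rfl fun k _ => ?_
  have hchoose : algebraMap ℂ A ((descPochhammer ℤ k).smeval a) =
      ((descPochhammer ℤ k).map (Int.castRingHom A)).eval (algebraMap ℂ A a) := by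
    rw [← Polynomial.aeval_eq_smeval, Polynomial.eval_map, ← Polynomial.aeval_algebraMap_apply]
    rfl
  rw [PowerSeries.binomialSeries_coeff, smul_eq_mul, mul_one, Ring.choose_eq_smul,
    Polynomial.eval_mul, Polynomial.eval_C, ← hchoose, smul_eq_mul, mul_smul, smul_mul_assoc,
    mul_comm (N ^ k), ← Algebra.smul_def]

lemma binomialPow_natCast {N : A} {n : ℕ} (hN : N ^ n = 0) (m : ℕ) :
    binomialPow n (m : ℂ) N = (1 + N) ^ m := by
  have : PowerSeries.binomialSeries ℂ (m : ℂ) =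
      ((1 + Polynomial.X : Polynomial ℂ) ^ m : Polynomial ℂ) := by
    simp
  rw [binomialPow, this, truncEval_coe hN, map_pow, map_add, map_one, Polynomial.aeval_X]

lemma binomialPow_add {N : A} {n : ℕ} (hN : N ^ n = 0) (a b : ℂ) :
    binomialPow n (a + b) N = binomialPow n a N * binomialPow n b N := by
  rw [binomialPow, PowerSeries.binomialSeries_add, truncEval_mul hN]
  rfl

lemma binomialPow_sub_one_mem {I : Ideal A} {N : A} (hN : N ∈ I) {n : ℕ} (hn : n ≠ 0) (a : ℂ) :
    binomialPow n a N - 1 ∈ I := by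
  simpa [binomialPow] using truncEval_sub_constantCoeff_mem hN hn (PowerSeries.binomialSeries ℂ a)

variable {I : Ideal A} {n : ℕ}

lemma binomialPow_mul_self (hI : ∀ N ∈ I, N ^ n = 0) {N M : A} (hN : N ∈ I) (hM : M ∈ I) (a : ℂ) :
    binomialPow n a (N + M + N * M) = binomialPow n a N * binomialPow n a M := by
  refine (isPolynomialFamily_binomialPow n _).ext
    ((isPolynomialFamily_binomialPow n N).mul (isPolynomialFamily_binomialPow n M))
    (fun m => ?_) a
  rw [binomialPow_natCast (hI _ (I.add_mem (I.add_mem hN hM) (I.mul_mem_left N hM))),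
    binomialPow_natCast (hI N hN), binomialPow_natCast (hI M hM), ← mul_pow]
  ring

lemma binomialPow_binomialPow (hI : ∀ N ∈ I, N ^ n = 0) {N : A} (hN : N ∈ I) (hn : n ≠ 0)
    (a b : ℂ) : binomialPow n a (binomialPow n b N - 1) = binomialPow n (a * b) N := by
  refine (isPolynomialFamily_binomialPow n _).ext
    ((isPolynomialFamily_binomialPow n N).comp_mul_const b) (fun m => ?_) a
  rw [binomialPow_natCast (hI _ (binomialPow_sub_one_mem hN hn b)), add_sub_cancel]
  induction m with
  | zero => simpa using (binomialPow_natCast (hI N hN) 0).symm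
  | succ m ih =>
    rw [pow_succ, ih, Nat.cast_succ, add_one_mul, binomialPow_add (hI N hN)]

/-- `Φ` equals `exp L` up to an element of the ideal `I`. -/
def HasLog (I : Ideal A) (L : ℂ) (Φ : A) : Prop := Complex.exp (-L) • Φ - 1 ∈ I

lemma exp_neg_smul_mul_sub_one (L M : ℂ) (Φ Ψ : A) :
    Complex.exp (-(L + M)) • (Φ * Ψ) - 1 =
      (Complex.exp (-L) • Φ - 1) + (Complex.exp (-M) • Ψ - 1) +
      (Complex.exp (-L) • Φ - 1) * (Complex.exp (-M) • Ψ - 1) := by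
  rw [neg_add, Complex.exp_add, ← smul_mul_smul_comm]; ring

lemma exp_neg_smul_complexPow (n : ℕ) (L a : ℂ) (Φ : A) :
    Complex.exp (-(a * L)) • complexPow n L a Φ = binomialPow n a (Complex.exp (-L) • Φ - 1) := by
  rw [complexPow, smul_smul, ← Complex.exp_add, neg_add_cancel, Complex.exp_zero, one_smul]

lemma hasLog_zero_one : HasLog I 0 1 := by simp [HasLog]

namespace HasLog

variable {L M : ℂ} {Φ Ψ : A}

lemma mul (h : HasLog I L Φ) (h' : HasLog I M Ψ) : HasLog I (L + M) (Φ * Ψ) := by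
  rw [HasLog, exp_neg_smul_mul_sub_one]
  exact I.add_mem (I.add_mem h h') (I.mul_mem_left _ h')

lemma prod {ι : Type*} {s : Finset ι} {L : ι → ℂ} {Φ : ι → A}
    (h : ∀ i ∈ s, HasLog I (L i) (Φ i)) : HasLog I (∑ i ∈ s, L i) (∏ i ∈ s, Φ i) := by
  classical
  induction s using Finset.induction_on with
  | empty => exact hasLog_zero_one
  | insert i s hi ih =>
    rw [Finset.sum_insert hi, Finset.prod_insert hi]
    exact (h i (s.mem_insert_self i)).mul (ih fun j hj => h j (Finset.mem_insert_of_mem hj))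

lemma isUnit (hI : ∀ N ∈ I, N ^ n = 0) (h : HasLog I L Φ) : IsUnit Φ := by
  have hu : IsUnit (Complex.exp (-L) • Φ) := by
    simpa using IsNilpotent.isUnit_add_one ⟨n, hI _ h⟩
  rw [Algebra.smul_def] at hu
  exact isUnit_of_mul_isUnit_right hu

lemma complexPow (h : HasLog I L Φ) (hn : n ≠ 0) (a : ℂ) :
    HasLog I (a * L) (complexPow n L a Φ) := by
  rw [HasLog, exp_neg_smul_complexPow]
  exact binomialPow_sub_one_mem h hn a

lemma complexPow_one (hI : ∀ N ∈ I, N ^ n = 0) (h : HasLog I L Φ) :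
    ThreePointSCFT.complexPow n L 1 Φ = Φ := by
  have := binomialPow_natCast (hI _ h) 1
  rw [Nat.cast_one, pow_one, add_sub_cancel] at this
  rw [ThreePointSCFT.complexPow, this, one_mul, smul_smul, ← Complex.exp_add, add_neg_cancel,
    Complex.exp_zero, one_smul]

end HasLog

variable {L M : ℂ} {Φ Ψ : A}

lemma complexPow_zero (hn : n ≠ 0) (L : ℂ) (Φ : A) : complexPow n L 0 Φ = 1 := by
  obtain ⟨m, rfl⟩ := Nat.exists_eq_succ_of_ne_zero hn
  simp [complexPow, binomialPow, truncEval]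

lemma complexPow_add (hI : ∀ N ∈ I, N ^ n = 0) (h : HasLog I L Φ) (a b : ℂ) :
    complexPow n L (a + b) Φ = complexPow n L a Φ * complexPow n L b Φ := by
  simp only [complexPow]
  rw [binomialPow_add (hI _ h), smul_mul_smul_comm, ← Complex.exp_add, add_mul]

lemma complexPow_mul (hI : ∀ N ∈ I, N ^ n = 0) (h : HasLog I L Φ) (h' : HasLog I M Ψ) (a : ℂ) :
    complexPow n (L + M) a (Φ * Ψ) = complexPow n L a Φ * complexPow n M a Ψ := by
  simp only [complexPow]
  rw [exp_neg_smul_mul_sub_one, binomialPow_mul_self hI h h', smul_mul_smul_comm,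
    ← Complex.exp_add, mul_add]

lemma complexPow_complexPow (hI : ∀ N ∈ I, N ^ n = 0) (h : HasLog I L Φ) (hn : n ≠ 0) (a b : ℂ) :
    complexPow n (b * L) a (complexPow n L b Φ) = complexPow n L (a * b) Φ := by
  rw [complexPow, exp_neg_smul_complexPow, binomialPow_binomialPow hI h hn, ← mul_assoc]
  rfl

lemma complexPow_zero_one (hI : ∀ N ∈ I, N ^ n = 0) (hn : n ≠ 0) (a : ℂ) :
    complexPow n 0 a (1 : A) = 1 := by
  have h := complexPow_complexPow hI (hasLog_zero_one (A := A)) hn a 0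
  rwa [zero_mul, mul_zero, complexPow_zero hn] at h

lemma complexPow_prod (hI : ∀ N ∈ I, N ^ n = 0) (hn : n ≠ 0) {ι : Type*} {s : Finset ι}
    {L : ι → ℂ} {Φ : ι → A} (h : ∀ i ∈ s, HasLog I (L i) (Φ i)) (a : ℂ) :
    complexPow n (∑ i ∈ s, L i) a (∏ i ∈ s, Φ i) = ∏ i ∈ s, complexPow n (L i) a (Φ i) := by
  classical
  induction s using Finset.induction_on with
  | empty => exact complexPow_zero_one hI hn a
  | insert i s hi ih =>
    have hs : ∀ j ∈ s, HasLog I (L j) (Φ j) := fun j hj => h j (Finset.mem_insert_of_mem hj)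
    rw [Finset.sum_insert hi, Finset.prod_insert hi, Finset.prod_insert hi,
      complexPow_mul hI (h i (s.mem_insert_self i)) (HasLog.prod hs), ih hs]

end CommutativeComplexPowers

section Nilpotent

variable {A : Type*} [Ring A] {ι : Type*} {δ : ι → A}

lemma mul_list_prod_eq_zero (hsq : ∀ i, δ i * δ i = 0) (hanti : ∀ i j, δ i * δ j = -(δ j * δ i))
    {i : ι} {l : List ι} (hi : i ∈ l) : δ i * (l.map δ).prod = 0 := by
  induction l with
  | nil => simp at hi
  | cons j t ih =>
    rw [List.map_cons, List.prod_cons, ← mul_assoc]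
    rcases List.mem_cons.1 hi with rfl | h
    · rw [hsq, zero_mul]
    · rw [hanti, neg_mul, mul_assoc, ih h, mul_zero, neg_zero]

lemma mul_mul_eq_zero_of_mem_span {Y w N : A} (hY : ∀ b, Y * b = b * Y)
    (h : ∀ i, Y * (δ i * w) = 0) (hN : N ∈ Ideal.span (Set.range δ)) : Y * (N * w) = 0 := by
  induction hN using Submodule.span_induction with
  | mem x hx => obtain ⟨i, rfl⟩ := hx; exact h i
  | zero => simp
  | add x y _ _ hx hy => rw [add_mul, mul_add, hx, hy, add_zero]
  | smul a x _ hx => rw [smul_eq_mul, mul_assoc, ← mul_assoc, hY, mul_assoc, hx, mul_zero]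

lemma pow_card_succ_eq_zero_of_mem_span [Fintype ι] (hsq : ∀ i, δ i * δ i = 0)
    (hanti : ∀ i j, δ i * δ j = -(δ j * δ i)) {N : A} (hc : ∀ b, N * b = b * N)
    (hN : N ∈ Ideal.span (Set.range δ)) : N ^ (Fintype.card ι + 1) = 0 := by
  classical
  -- Each factor of `N` contributes a new generator, and the product of all of them kills `N`.
  have hpow : ∀ m b, N ^ m * b = b * N ^ m := fun m b => (Commute.pow_left (hc b) m)
  have key : ∀ (m : ℕ) (l : List ι), l.Nodup → l.length + m = Fintype.card ι →
      N ^ (m + 1) * (l.map δ).prod = 0 := by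
    intro m
    induction m with
    | zero =>
      intro l hl hlen
      have hall : ∀ i, i ∈ l := fun i => by
        have : l.toFinset = Finset.univ := by
          rw [← Finset.card_eq_iff_eq_univ, List.toFinset_card_of_nodup hl]; simpa using hlen
        rw [← List.mem_toFinset, this]; exact Finset.mem_univ i
      have := mul_mul_eq_zero_of_mem_span (Y := 1) (w := (l.map δ).prod) (by simp)
        (fun i => by rw [mul_list_prod_eq_zero hsq hanti (hall i), mul_zero]) hN
      simpa using this
    | succ m ih =>
      intro l hl hlen
      rw [pow_succ, mul_assoc]
      refine mul_mul_eq_zero_of_mem_span (hpow _) (fun i => ?_) hN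
      by_cases hi : i ∈ l
      · rw [mul_list_prod_eq_zero hsq hanti hi, mul_zero]
      · have := ih (i :: l) (List.nodup_cons.2 ⟨hi, hl⟩) (by simp; omega)
        simpa using this
  simpa using key (Fintype.card ι) [] List.nodup_nil (by simp)

end Nilpotent

section ExteriorAlgebraParity

open CliffordAlgebra (evenOdd)
open ExteriorAlgebra (ι)

variable {R M : Type*} [CommRing R] [AddCommGroup M] [Module R M]

lemma ι_mul_ι_anticomm (v w : M) : ι R v * ι R w = -(ι R w * ι R v) :=
  eq_neg_of_add_eq_zero_left (ExteriorAlgebra.ι_add_mul_swap v w)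

lemma commute_ι_mul_ι (v w : M) (y : ExteriorAlgebra R M) : Commute (ι R v * ι R w) y := by
  induction y using ExteriorAlgebra.induction with
  | algebraMap r => exact (Algebra.commutes r _).symm
  | ι u =>
    change ι R v * ι R w * ι R u = ι R u * (ι R v * ι R w)
    rw [← mul_assoc, ι_mul_ι_anticomm u v, neg_mul, mul_assoc, mul_assoc, ι_mul_ι_anticomm u w,
      mul_neg, neg_neg]
  | mul a b ha hb => exact ha.mul_right hb
  | add a b ha hb => exact ha.add_right hb

lemma commute_of_mem_even {r : ExteriorAlgebra R M} (hr : r ∈ evenOdd (0 : QuadraticForm R M) 0)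
    (y : ExteriorAlgebra R M) : Commute r y := by
  induction r, hr using CliffordAlgebra.even_induction with
  | algebraMap a => exact Algebra.commutes a y
  | add a b _ _ ha hb => exact ha.add_left hb
  | ι_mul_ι_mul v w a _ ha => exact (commute_ι_mul_ι v w y).mul_left ha

lemma ι_anticomm_of_mem_odd (v : M) {z : ExteriorAlgebra R M}
    (hz : z ∈ evenOdd (0 : QuadraticForm R M) 1) : ι R v * z = -(z * ι R v) := by
  induction z, hz using CliffordAlgebra.odd_induction with
  | ι w => exact ι_mul_ι_anticomm v w
  | add a b _ _ ha hb => rw [mul_add, add_mul, ha, hb, neg_add]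
  | ι_mul_ι_mul u w a _ ha =>
    rw [← mul_assoc, ← (commute_ι_mul_ι u w (ι R v)).eq, mul_assoc, ha, mul_neg, ← mul_assoc]

lemma odd_anticomm {y z : ExteriorAlgebra R M} (hy : y ∈ evenOdd (0 : QuadraticForm R M) 1)
    (hz : z ∈ evenOdd (0 : QuadraticForm R M) 1) : y * z = -(z * y) := by
  induction y, hy using CliffordAlgebra.odd_induction with
  | ι v => exact ι_anticomm_of_mem_odd v hz
  | add a b _ _ ha hb => rw [add_mul, mul_add, ha, hb, neg_add]
  | ι_mul_ι_mul u w a _ ha =>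
    rw [mul_assoc, ha, mul_neg, ← mul_assoc, (commute_ι_mul_ι u w z).eq, mul_assoc]

lemma odd_mul_self {y : ExteriorAlgebra R M} (hy : y ∈ evenOdd (0 : QuadraticForm R M) 1) :
    y * y = 0 := by
  induction y, hy using CliffordAlgebra.odd_induction with
  | ι v => exact ExteriorAlgebra.ι_sq_zero v
  | add a b ha' hb' ha hb =>
    rw [mul_add, add_mul, add_mul, ha, hb, odd_anticomm ha' hb', zero_add, add_zero, add_neg_cancel]
  | ι_mul_ι_mul u w a _ ha =>
    have h : ι R u * ι R w * a = a * (ι R u * ι R w) := commute_ι_mul_ι u w a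
    change ι R u * ι R w * a * (ι R u * ι R w * a) = 0
    rw [mul_assoc, ← mul_assoc a, ← h, mul_assoc _ a, ha, mul_zero, mul_zero]

lemma contractLeft_even_mul (d : Module.Dual R M) {r : ExteriorAlgebra R M}
    (hr : r ∈ evenOdd (0 : QuadraticForm R M) 0) (y : ExteriorAlgebra R M) :
    CliffordAlgebra.contractLeft d (r * y) =
      CliffordAlgebra.contractLeft d r * y + r * CliffordAlgebra.contractLeft d y := by
  induction r, hr using CliffordAlgebra.even_induction with
  | algebraMap a =>
    rw [CliffordAlgebra.contractLeft_algebraMap_mul, CliffordAlgebra.contractLeft_algebraMap,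
      zero_mul, zero_add]
  | add a b _ _ ha hb => rw [add_mul, map_add, map_add, ha, hb, add_mul, add_mul]; abel
  | ι_mul_ι_mul u w a _ ha =>
    simp only [mul_assoc, CliffordAlgebra.contractLeft_ι_mul, ha, mul_add, mul_sub, sub_mul,
      smul_mul_assoc, mul_smul_comm]
    abel

end ExteriorAlgebraParity

/-- The even part of the Grassmann algebra: a commutative algebra, which contains the intervals,
their powers and the three-point functions. -/
abbrev EvenGrassmann : Type := CliffordAlgebra.even (0 : QuadraticForm ℂ (Gen → ℂ))

namespace EvenGrassmann

open CliffordAlgebra (evenOdd)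
open ExteriorAlgebra (ι)

instance : CommRing EvenGrassmann :=
  { (inferInstance : Ring EvenGrassmann) with
    mul_comm := fun r s => Subtype.ext (commute_of_mem_even r.2 s.1) }

/-- The inclusion of the even part in the Grassmann algebra. -/
def val : EvenGrassmann →ₐ[ℂ] Grassmann :=
  (CliffordAlgebra.even (0 : QuadraticForm ℂ (Gen → ℂ))).val

lemma val_injective : Function.Injective val := Subtype.val_injective

lemma val_mem_even (r : EvenGrassmann) : val r ∈ evenOdd (0 : QuadraticForm ℂ (Gen → ℂ)) 0 := r.2

lemma val_mul_comm (r : EvenGrassmann) (y : Grassmann) : val r * y = y * val r :=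
  commute_of_mem_even r.val_mem_even y

lemma mul_val_mul (r : EvenGrassmann) (y z : Grassmann) : y * (val r * z) = val r * (y * z) := by
  rw [← mul_assoc, ← val_mul_comm, mul_assoc]

lemma val_mul_ι_mem_odd (r : EvenGrassmann) (v : Gen → ℂ) :
    val r * ι ℂ v ∈ evenOdd (0 : QuadraticForm ℂ (Gen → ℂ)) 1 :=
  CliffordAlgebra.evenOdd_mul_le _ 0 1
    (Submodule.mul_mem_mul r.val_mem_even (CliffordAlgebra.ι_mem_evenOdd_one _ v))

/-- The product of two odd vectors, as an even element. -/
def ofVectors (v w : Gen → ℂ) : EvenGrassmann :=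
  ⟨ι ℂ v * ι ℂ w, CliffordAlgebra.ι_mul_ι_mem_evenOdd_zero _ v w⟩

lemma val_ofVectors (v w : Gen → ℂ) : val (ofVectors v w) = ι ℂ v * ι ℂ w := rfl

lemma val_ringInverse {r : EvenGrassmann} (hr : IsUnit r) :
    Ring.inverse (val r) = val (Ring.inverse r) := by
  obtain ⟨u, rfl⟩ := hr
  rw [Ring.inverse_unit]
  exact Ring.inverse_unit (u.map (val : EvenGrassmann →* Grassmann))

end EvenGrassmann

/-- The nilpotent product `θ_j^d θbar_i^c`, as an even element. -/
def pair (j : Fin 3) (d : Fin 2) (i : Fin 3) (c : Fin 2) : EvenGrassmann :=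
  EvenGrassmann.ofVectors (Pi.single (Sum.inl (j, d)) 1) (Pi.single (Sum.inr (i, c)) 1)

open EvenGrassmann (val)

lemma val_pair (j : Fin 3) (d : Fin 2) (i : Fin 3) (c : Fin 2) :
    val (pair j d i c) = θ j d * θbar i c := rfl

/-- The even elements of the left ideal generated by odd elements `δ k`. -/
def evenIdeal {ι : Type*} (δ : ι → Grassmann) : Ideal EvenGrassmann :=
  (Ideal.span (Set.range δ)).comap val

lemma pow_eq_zero_of_mem_evenIdeal {ι : Type*} [Fintype ι] {δ : ι → Grassmann}
    (hδ : ∀ k, δ k ∈ CliffordAlgebra.evenOdd (0 : QuadraticForm ℂ (Gen → ℂ)) 1)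
    {N : EvenGrassmann} (hN : N ∈ evenIdeal δ) : N ^ (Fintype.card ι + 1) = 0 := by
  refine EvenGrassmann.val_injective ?_
  rw [map_pow, map_zero]
  exact pow_card_succ_eq_zero_of_mem_span (fun k => odd_mul_self (hδ k))
    (fun k l => odd_anticomm (hδ k) (hδ l)) N.val_mul_comm hN

/-- The even elements of the left ideal generated by the coordinates `θ_i^a`; all nilpotent parts
below belong to it. -/
def nilIdeal : Ideal EvenGrassmann := evenIdeal fun p : Fin 3 × Fin 2 => θ p.1 p.2

lemma pow_seven_eq_zero {N : EvenGrassmann} (hN : N ∈ nilIdeal) : N ^ 7 = 0 :=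
  pow_eq_zero_of_mem_evenIdeal (fun _ => CliffordAlgebra.ι_mem_evenOdd_one _ _) hN

lemma pair_mem_nilIdeal (j : Fin 3) (d : Fin 2) (i : Fin 3) (c : Fin 2) :
    pair j d i c ∈ nilIdeal := by
  change θ j d * θbar i c ∈ Ideal.span (Set.range fun p : Fin 3 × Fin 2 => θ p.1 p.2)
  rw [θ, θbar, ι_mul_ι_anticomm, ← neg_mul]
  exact Ideal.mul_mem_left _ _ (Ideal.subset_span ⟨(j, d), rfl⟩)

section Intervals

/-- The matrix `∑ μ, (x_i - x_j)^μ σ^μ`. -/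
def bodyMatrix (i j : Fin 3) (x : Config) : Matrix (Fin 2) (Fin 2) ℂ :=
  ∑ μ, ((x i μ - x j μ : ℝ) : ℂ) • pauli μ

lemma det_bodyMatrix (i j : Fin 3) (x : Config) : (bodyMatrix i j x).det = bodySq i j x := by
  rw [Matrix.det_fin_two]
  simp only [bodyMatrix, bodySq, pauli, minkowski, Fin.sum_univ_four, Matrix.add_apply,
    Matrix.smul_apply, Matrix.of_apply, Matrix.cons_val, smul_eq_mul, Complex.ofReal_sub]
  linear_combination (((x i 2 : ℂ) - x j 2) ^ 2) * Complex.I_sq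

lemma bodyMatrix_sub (i j k : Fin 3) (x : Config) :
    bodyMatrix i j x = bodyMatrix i k x - bodyMatrix j k x := by
  simp only [bodyMatrix, ← Finset.sum_sub_distrib, ← sub_smul, Complex.ofReal_sub,
    sub_sub_sub_cancel_right]

lemma bodyMatrix_self (i : Fin 3) (x : Config) : bodyMatrix i i x = 0 := by
  rw [bodyMatrix_sub i i i, sub_self]

/-- The interval `x_{ībar j}` as an even element. -/
def evenInterval (i j : Fin 3) (μ : Fin 4) (x : Config) : EvenGrassmann :=
  algebraMap ℂ EvenGrassmann ((x i μ - x j μ : ℝ) : ℂ) +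
    Complex.I • ∑ a, ∑ b, pauli μ a b • (pair i a i b + pair j a j b - (2 : ℂ) • pair j a i b)

lemma val_evenInterval (i j : Fin 3) (μ : Fin 4) (x : Config) :
    val (evenInterval i j μ x) = interval i j μ x := by
  simp only [evenInterval, interval, xMinus, xPlus, bilin, map_add, map_sub, map_smul, map_sum,
    val_pair, AlgHom.commutes, Complex.ofReal_sub, smul_add, smul_sub, Finset.sum_add_distrib,
    Finset.sum_sub_distrib, mul_smul, Finset.smul_sum, smul_comm (2 : ℂ)]
  abel

lemma sum_pauli_smul_sum_pauli {S : Type*} [AddCommGroup S] [Module ℂ S] (p : Fin 2 → Fin 2 → S)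
    (c d : Fin 2) :
    ∑ μ, pauli μ c d • ∑ a, ∑ b, pauli μ a b • p a b = (2 : ℂ) • p d c := by
  fin_cases c <;> fin_cases d <;>
    simp [pauli, Fin.sum_univ_four, Fin.sum_univ_two, smul_smul, two_smul, smul_add] <;> abel

lemma det_sum_pauli_smul {S : Type*} [CommRing S] [Algebra ℂ S] (t : Fin 4 → S) :
    (Matrix.of fun c d : Fin 2 => ∑ μ, pauli μ c d • t μ).det =
      ∑ μ, minkowski μ • (t μ * t μ) := by
  have hI : algebraMap ℂ S Complex.I * algebraMap ℂ S Complex.I = -1 := by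
    rw [← map_mul, Complex.I_mul_I, map_neg, map_one]
  rw [Matrix.det_fin_two]
  simp only [pauli, minkowski, Fin.sum_univ_four, Algebra.smul_def, Fin.isValue,
    Matrix.cons_val_zero, Matrix.of_apply, Matrix.cons_val', Matrix.cons_val_fin_one,
    Matrix.cons_val_one, Matrix.cons_val, map_one, one_mul, map_zero, zero_mul, add_zero, map_neg,
    neg_mul, zero_add]
  linear_combination (t 2 * t 2) * hI

/-- The matrix `∑ μ, x_{ībar j}^μ σ^μ`. -/
def intervalMatrix (i j : Fin 3) (x : Config) : Matrix (Fin 2) (Fin 2) EvenGrassmann :=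
  Matrix.of fun c d => ∑ μ, pauli μ c d • evenInterval i j μ x

lemma intervalMatrix_apply (i j : Fin 3) (x : Config) (c d : Fin 2) :
    intervalMatrix i j x c d = algebraMap ℂ EvenGrassmann (bodyMatrix i j x c d) +
      (2 * Complex.I) • (pair i d i c + pair j d j c - (2 : ℂ) • pair j d i c) := by
  simp only [intervalMatrix, evenInterval, Matrix.of_apply, smul_add, Finset.sum_add_distrib,
    smul_comm _ Complex.I]
  rw [← Finset.smul_sum, sum_pauli_smul_sum_pauli, smul_smul, mul_comm Complex.I]
  congr 1
  rw [bodyMatrix, Matrix.sum_apply, map_sum]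
  refine Finset.sum_congr rfl fun μ _ => ?_
  rw [Matrix.smul_apply, smul_eq_mul, map_mul, Algebra.smul_def, mul_comm]

/-- The square `(x_{ībar j})²`, as the determinant of the matrix of the interval. -/
def intervalDet (i j : Fin 3) (x : Config) : EvenGrassmann := (intervalMatrix i j x).det

lemma intervalDet_eq_sum (i j : Fin 3) (x : Config) :
    intervalDet i j x = ∑ μ, minkowski μ • (evenInterval i j μ x * evenInterval i j μ x) :=
  det_sum_pauli_smul _

lemma val_intervalDet (i j : Fin 3) (x : Config) : val (intervalDet i j x) = intervalSq i j x := by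
  simp only [intervalDet_eq_sum, intervalSq, map_sum, map_smul, map_mul, val_evenInterval]

lemma intervalDet_sub_bodySq_mem (i j : Fin 3) (x : Config) :
    intervalDet i j x - algebraMap ℂ EvenGrassmann (bodySq i j x) ∈ nilIdeal := by
  rw [← Ideal.Quotient.eq, intervalDet, ← det_bodyMatrix, RingHom.map_det, RingHom.map_det,
    RingHom.map_det]
  congr 1
  ext c d
  refine Ideal.Quotient.eq.2 ?_
  rw [intervalMatrix_apply, RingHom.mapMatrix_apply, Matrix.map_apply, add_sub_cancel_left]
  exact nilIdeal.smul_of_tower_mem _ (sub_mem (add_mem (pair_mem_nilIdeal _ _ _ _)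
    (pair_mem_nilIdeal _ _ _ _)) (nilIdeal.smul_of_tower_mem _ (pair_mem_nilIdeal _ _ _ _)))

lemma hasLog_intervalDet {i j : Fin 3} {x : Config} {L : ℂ} (h : Complex.exp L = bodySq i j x) :
    HasLog nilIdeal L (intervalDet i j x) := by
  have := nilIdeal.smul_of_tower_mem (Complex.exp (-L)) (intervalDet_sub_bodySq_mem i j x)
  rwa [smul_sub, ← h, Algebra.algebraMap_eq_smul_one, smul_smul, ← Complex.exp_add, neg_add_cancel,
    Complex.exp_zero, one_smul] at this

end Intervals

section CrossRatio

/-- The matrix of the products `(θ_j - θ_0)^d (θbar_i - θbar_0)^c`. -/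
def pairMatrix (i j : Fin 3) : Matrix (Fin 2) (Fin 2) EvenGrassmann :=
  Matrix.of fun c d => pair j d i c - pair j d 0 c - pair 0 d i c + pair 0 d 0 c

lemma val_pairMatrix (i j : Fin 3) (c d : Fin 2) :
    val (pairMatrix i j c d) = (θ j d - θ 0 d) * (θbar i c - θbar 0 c) := by
  simp only [pairMatrix, Matrix.of_apply, map_add, map_sub, val_pair]
  noncomm_ring

lemma pairMatrix_zero_left (j : Fin 3) : pairMatrix 0 j = 0 := by
  ext1 c d
  simp [pairMatrix]

lemma intervalMatrix_eq_sub (i j : Fin 3) (x : Config) :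
    intervalMatrix i j x = intervalMatrix i 0 x - intervalMatrix j 0 x -
      (4 * Complex.I) • (pairMatrix i j - pairMatrix j j) := by
  ext1 c d
  simp only [intervalMatrix_apply, pairMatrix, bodyMatrix_sub i j 0, Matrix.of_apply,
    Matrix.sub_apply, Matrix.smul_apply, map_sub]
  module

lemma intervalMatrix_self (i : Fin 3) (x : Config) : intervalMatrix i i x = 0 := by
  rw [intervalMatrix_eq_sub, sub_self, sub_self, smul_zero, sub_zero]

/-- If `pairMatrix i j` factors as `x_{ībar 0} T_j`, then
`x_{ībar j} = (x_{ībar 0} - x_{jbar 0}) (1 - 4 i T_j)`, and the last factor drops out of the ratio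
of the two products. -/
lemma map_intervalDet_cross {K : Type*} [CommRing K] [Algebra ℂ K] (φ : EvenGrassmann →ₐ[ℂ] K)
    {x : Config} {T : Fin 3 → Matrix (Fin 2) (Fin 2) K}
    (hT : ∀ i j, φ.mapMatrix (pairMatrix i j) = φ.mapMatrix (intervalMatrix i 0 x) * T j) :
    φ (intervalDet 1 2 x * intervalDet 2 0 x * intervalDet 0 1 x) =
      φ (intervalDet 1 0 x * intervalDet 0 2 x * intervalDet 2 1 x) := by
  set A : Fin 3 → Matrix (Fin 2) (Fin 2) K := fun i => φ.mapMatrix (intervalMatrix i 0 x)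
  have hX : ∀ i j, φ (intervalDet i j x) =
      (A i - A j).det * (1 - (4 * Complex.I) • T j).det := fun i j => by
    rw [intervalDet, AlgHom.map_det, intervalMatrix_eq_sub, map_sub, map_sub, map_smul, map_sub,
      hT, hT, ← Matrix.det_mul, ← sub_mul, mul_sub, mul_one, mul_smul_comm]
  have hswap : ∀ i j, (A i - A j).det = (A j - A i).det := fun i j => by
    rw [← neg_sub, Matrix.det_neg, Fintype.card_fin, neg_one_sq, one_mul]
  simp only [map_mul, hX, hswap 1 0, hswap 0 2, hswap 2 1]
  ring

/-- The odd spinor `x_{ībar 0}⁻¹ (θbar_i - θbar_0)`. -/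
def invSpinor (i : Fin 3) (x : Config) (k : Fin 2) : Grassmann :=
  ∑ c, val ((intervalMatrix i 0 x)⁻¹ k c) * (θbar i c - θbar 0 c)

lemma invSpinor_mem_odd (i : Fin 3) (x : Config) (k : Fin 2) :
    invSpinor i x k ∈ CliffordAlgebra.evenOdd (0 : QuadraticForm ℂ (Gen → ℂ)) 1 := by
  refine sum_mem fun c _ => ?_
  rw [θbar, θbar, ← map_sub]
  exact EvenGrassmann.val_mul_ι_mem_odd _ _

lemma val_inv_mul_pairMatrix (i j : Fin 3) (x : Config) (k d : Fin 2) :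
    val (((intervalMatrix i 0 x)⁻¹ * pairMatrix i j) k d) = (θ j d - θ 0 d) * invSpinor i x k := by
  simp only [Matrix.mul_apply, map_sum, map_mul, val_pairMatrix, invSpinor, Finset.mul_sum,
    EvenGrassmann.mul_val_mul]

/-- The even elements of the left ideal generated by the two components of
`x_{1bar 0}⁻¹ (θbar_1 - θbar_0) - x_{2bar 0}⁻¹ (θbar_2 - θbar_0)`, which contains the nilpotent
three-point invariant. -/
def crossIdeal (x : Config) : Ideal EvenGrassmann :=
  evenIdeal fun k => invSpinor 1 x k - invSpinor 2 x k

lemma pow_three_eq_zero {x : Config} {N : EvenGrassmann} (hN : N ∈ crossIdeal x) : N ^ 3 = 0 :=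
  pow_eq_zero_of_mem_evenIdeal
    (fun k => sub_mem (invSpinor_mem_odd 1 x k) (invSpinor_mem_odd 2 x k)) hN

lemma inv_mul_pairMatrix_sub_mem (j : Fin 3) (x : Config) (k d : Fin 2) :
    ((intervalMatrix 1 0 x)⁻¹ * pairMatrix 1 j) k d -
      ((intervalMatrix 2 0 x)⁻¹ * pairMatrix 2 j) k d ∈ crossIdeal x := by
  rw [crossIdeal, evenIdeal, Ideal.mem_comap, map_sub, val_inv_mul_pairMatrix,
    val_inv_mul_pairMatrix, ← mul_sub]
  exact Ideal.mul_mem_left _ _ (Ideal.subset_span ⟨k, rfl⟩)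

lemma intervalDet_cross_sub_mem {x : Config} (h10 : IsUnit (intervalDet 1 0 x))
    (h20 : IsUnit (intervalDet 2 0 x)) :
    intervalDet 1 2 x * intervalDet 2 0 x * intervalDet 0 1 x -
      intervalDet 1 0 x * intervalDet 0 2 x * intervalDet 2 1 x ∈ crossIdeal x := by
  set φ := Ideal.Quotient.mkₐ ℂ (crossIdeal x)
  refine Ideal.Quotient.eq.1 (map_intervalDet_cross φ
    (T := fun j => φ.mapMatrix ((intervalMatrix 1 0 x)⁻¹ * pairMatrix 1 j)) fun i j => ?_)
  have hT : φ.mapMatrix ((intervalMatrix 1 0 x)⁻¹ * pairMatrix 1 j) =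
      φ.mapMatrix ((intervalMatrix 2 0 x)⁻¹ * pairMatrix 2 j) := by
    ext k d
    exact Ideal.Quotient.eq.2 (inv_mul_pairMatrix_sub_mem j x k d)
  fin_cases i
  · simp [pairMatrix_zero_left, intervalMatrix_self]
  · change _ = φ.mapMatrix (intervalMatrix 1 0 x) * _
    rw [← map_mul, Matrix.mul_nonsing_inv_cancel_left _ _ h10]
    rfl
  · change _ = φ.mapMatrix (intervalMatrix 2 0 x) * _
    rw [hT, ← map_mul, Matrix.mul_nonsing_inv_cancel_left _ _ h20]
    rfl

end CrossRatio

section Monomials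

/-- Symmetric logarithms of the squares `(x_i - x_j)²` at the configuration `x`. -/
structure IsLogAt (x : Config) (L : Fin 3 → Fin 3 → ℂ) : Prop where
  symm : ∀ i j, i ≠ j → L i j = L j i
  exp_eq : ∀ i j, i ≠ j → Complex.exp (L i j) = bodySq i j x

lemma IsLogBranch.isLogAt {U : Set Config} {ℓ : Fin 3 → Fin 3 → Config → ℂ}
    (h : IsLogBranch U ℓ) {x : Config} (hx : x ∈ U) : IsLogAt x fun i j => ℓ i j x :=
  ⟨fun i j hij => h.symm i j hij x hx, fun i j hij => h.exp_eq i j hij x hx⟩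

@[to_additive]
lemma prod_offDiag_fin_three {M : Type*} [CommMonoid M] (F : Fin 3 × Fin 3 → M) :
    ∏ p ∈ Finset.univ.offDiag, F p =
      F (0, 1) * F (1, 0) * F (0, 2) * F (2, 0) * F (1, 2) * F (2, 1) := by
  have : (Finset.univ : Finset (Fin 3)).offDiag =
      {(0, 1), (1, 0), (0, 2), (2, 0), (1, 2), (2, 1)} := by decide
  simp [this, mul_assoc]

/-- The product `∏ (x_{ībar j}²) ^ e_{ij}` over all `i ≠ j`. The diagonal of `e` is irrelevant. -/
def intervalMonomial (L : Fin 3 → Fin 3 → ℂ) (e : Matrix (Fin 3) (Fin 3) ℂ) (x : Config) :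
    EvenGrassmann :=
  ∏ p ∈ Finset.univ.offDiag, complexPow 13 (L p.1 p.2) (e p.1 p.2) (intervalDet p.1 p.2 x)

variable {x : Config} {L : Fin 3 → Fin 3 → ℂ}

lemma intervalMonomial_congr {e e' : Matrix (Fin 3) (Fin 3) ℂ}
    (h : ∀ i j, i ≠ j → e i j = e' i j) : intervalMonomial L e x = intervalMonomial L e' x :=
  Finset.prod_congr rfl fun p hp => by rw [h _ _ (Finset.mem_offDiag.1 hp).2.2]

lemma intervalMonomial_zero : intervalMonomial L 0 x = 1 :=
  Finset.prod_eq_one fun _ _ => complexPow_zero (by decide) _ _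

lemma intervalMonomial_single {i j : Fin 3} (hij : i ≠ j) (a : ℂ) :
    intervalMonomial L (Matrix.single i j a) x = complexPow 13 (L i j) a (intervalDet i j x) := by
  rw [intervalMonomial, Finset.prod_eq_single_of_mem (i, j) (by simpa using hij),
    Matrix.single_apply_same]
  rintro ⟨k, l⟩ - hkl
  rw [Matrix.single_apply_of_ne _ _ _ _ _ fun h => hkl (Prod.ext h.1.symm h.2.symm)]
  exact complexPow_zero (by decide) _ _

lemma intervalPow_eq_val {ℓ : Fin 3 → Fin 3 → Config → ℂ} {i j : Fin 3} (hij : i ≠ j) (a : ℂ) :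
    intervalPow ℓ i j a x =
      val (intervalMonomial (fun i j => ℓ i j x) (Matrix.single i j a) x) := by
  rw [intervalMonomial_single hij, map_complexPow, val_intervalDet, complexPow, binomialPow,
    truncEval_eq_sum]
  rfl

lemma pow_thirteen_eq_zero (N : EvenGrassmann) (hN : N ∈ nilIdeal) : N ^ 13 = 0 :=
  pow_eq_zero_of_le (by decide) (pow_seven_eq_zero hN)

/-- The exponents of the invariant `J_1`. -/
def crossExponent : Matrix (Fin 3) (Fin 3) ℂ := !![0, 1, -1; -1, 0, 1; 1, -1, 0]

/-- The exponents `Δ_{lm}`. -/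
def scalingExponent (η κ : Fin 3 → ℝ) : Matrix (Fin 3) (Fin 3) ℂ := Matrix.of fun l m => Δ η κ l m

namespace IsLogAt

variable (hL : IsLogAt x L)
include hL

lemma hasLog {p : Fin 3 × Fin 3} (hp : p ∈ Finset.univ.offDiag) :
    HasLog nilIdeal (L p.1 p.2) (intervalDet p.1 p.2 x) :=
  hasLog_intervalDet (hL.exp_eq _ _ (Finset.mem_offDiag.1 hp).2.2)

lemma intervalMonomial_add (e e' : Matrix (Fin 3) (Fin 3) ℂ) :
    intervalMonomial L (e + e') x = intervalMonomial L e x * intervalMonomial L e' x := by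
  rw [intervalMonomial, intervalMonomial, intervalMonomial, ← Finset.prod_mul_distrib]
  exact Finset.prod_congr rfl fun p hp => complexPow_add pow_thirteen_eq_zero (hL.hasLog hp) _ _

lemma inverse_val_intervalMonomial (e : Matrix (Fin 3) (Fin 3) ℂ) :
    Ring.inverse (val (intervalMonomial L e x)) = val (intervalMonomial L (-e) x) := by
  have h : intervalMonomial L e x * intervalMonomial L (-e) x = 1 := by
    rw [← hL.intervalMonomial_add, add_neg_cancel, intervalMonomial_zero]
  have hunit := IsUnit.of_mul_eq_one _ h
  rw [EvenGrassmann.val_ringInverse hunit]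
  congr 1
  rw [← mul_one (Ring.inverse _), Ring.inverse_mul_eq_iff_eq_mul _ _ _ hunit, h]

lemma intervalDet_eq {i j : Fin 3} (hij : i ≠ j) :
    intervalDet i j x = intervalMonomial L (Matrix.single i j 1) x := by
  rw [intervalMonomial_single hij,
    (hasLog_intervalDet (hL.exp_eq i j hij)).complexPow_one pow_thirteen_eq_zero]

lemma complexPow_intervalMonomial (e : Matrix (Fin 3) (Fin 3) ℂ) (a : ℂ) :
    complexPow 13 (∑ p ∈ Finset.univ.offDiag, e p.1 p.2 * L p.1 p.2) a (intervalMonomial L e x) =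
      intervalMonomial L (a • e) x := by
  rw [intervalMonomial, complexPow_prod pow_thirteen_eq_zero (by decide)
    fun p hp => (hL.hasLog hp).complexPow (by decide) (e p.1 p.2)]
  exact Finset.prod_congr rfl fun p hp =>
    complexPow_complexPow pow_thirteen_eq_zero (hL.hasLog hp) (by decide) _ _

lemma sum_crossExponent_mul :
    ∑ p ∈ Finset.univ.offDiag, crossExponent p.1 p.2 * L p.1 p.2 = 0 := by
  simp [sum_offDiag_fin_three, crossExponent, hL.symm 1 0, hL.symm 2 0, hL.symm 2 1]

lemma J1_eq : J1 x = val (intervalMonomial L crossExponent x) := by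
  rw [J1, X1PlusSq, X1MinusSq]
  simp (disch := decide) only [← val_intervalDet, hL.intervalDet_eq, ← map_mul,
    ← hL.intervalMonomial_add, hL.inverse_val_intervalMonomial]
  congr 2
  ext i j
  fin_cases i <;> fin_cases j <;> simp [crossExponent]

lemma I3PF_eq : I3PF x = val (intervalMonomial L crossExponent x - 1) := by
  rw [I3PF, hL.J1_eq, map_sub, map_one]

lemma crossMonomial_sub_one_mem : intervalMonomial L crossExponent x - 1 ∈ crossIdeal x := by
  have hunit : ∀ {i j : Fin 3}, i ≠ j → IsUnit (intervalDet i j x) := fun {i j} hij =>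
    (hasLog_intervalDet (hL.exp_eq i j hij)).isUnit pow_thirteen_eq_zero
  have hden : IsUnit (intervalDet 1 0 x * intervalDet 0 2 x * intervalDet 2 1 x) :=
    ((hunit (by decide)).mul (hunit (by decide))).mul (hunit (by decide))
  have hcross : intervalMonomial L crossExponent x *
        (intervalDet 1 0 x * intervalDet 0 2 x * intervalDet 2 1 x) =
      intervalDet 1 2 x * intervalDet 2 0 x * intervalDet 0 1 x := by
    simp (disch := decide) only [hL.intervalDet_eq, ← hL.intervalMonomial_add]
    congr 1
    ext i j
    fin_cases i <;> fin_cases j <;> simp [crossExponent]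
  rw [← (crossIdeal x).mul_unit_mem_iff_mem hden, sub_one_mul, hcross]
  exact intervalDet_cross_sub_mem (hunit (by decide)) (hunit (by decide))

lemma taylorEval_I3PF (f : PowerSeries ℂ) :
    taylorEval f (I3PF x) = val (truncEval 3 f (intervalMonomial L crossExponent x - 1)) := by
  rw [hL.I3PF_eq, ← truncEval_of_le (n := 13) (by decide)
    (pow_three_eq_zero hL.crossMonomial_sub_one_mem), map_truncEval, truncEval_eq_sum]
  rfl

lemma gpow_I3PF_add_one (a : ℂ) :
    gpow 0 a (I3PF x + 1) = val (intervalMonomial L (a • crossExponent) x) := by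
  rw [← hL.complexPow_intervalMonomial, hL.sum_crossExponent_mul, map_complexPow, I3PF,
    sub_add_cancel, hL.J1_eq, complexPow, binomialPow, truncEval_eq_sum]
  rfl

end IsLogAt

variable {ℓ : Fin 3 → Fin 3 → Config → ℂ} (hL : IsLogAt x fun i j => ℓ i j x)
include hL

lemma generalThreePoint_eq (η κ : Fin 3 → ℝ) (f : PowerSeries ℂ) :
    generalThreePoint ℓ η κ f x = val (
      truncEval 3 f (intervalMonomial (fun i j => ℓ i j x) crossExponent x - 1) *
        intervalMonomial (fun i j => ℓ i j x) (-scalingExponent η κ) x) := by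
  rw [generalThreePoint, hL.taylorEval_I3PF, map_mul]
  simp (disch := decide) only [intervalPow_eq_val, ← map_mul, ← hL.intervalMonomial_add,
    hL.inverse_val_intervalMonomial]
  congr 2
  refine intervalMonomial_congr fun i j hij => ?_
  fin_cases i <;> fin_cases j <;> simp [scalingExponent] at hij ⊢

lemma chiralThreePoint_eq (η : Fin 3 → ℝ) :
    chiralThreePoint ℓ η x = val (intervalMonomial (fun i j => ℓ i j x)
      (-(Matrix.single 0 1 (η 1 : ℂ) + Matrix.single 0 2 (η 2 : ℂ))) x) := by
  rw [chiralThreePoint, intervalPow_eq_val (by decide), intervalPow_eq_val (by decide), ← map_mul,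
    ← hL.intervalMonomial_add, hL.inverse_val_intervalMonomial]

end Monomials

section Substitutions

open ExteriorAlgebra (ι)

lemma contractLeft_map {R M N : Type*} [CommRing R] [AddCommGroup M] [Module R M] [AddCommGroup N]
    [Module R N] (p : M →ₗ[R] N) (d : Module.Dual R N) (y : ExteriorAlgebra R M) :
    CliffordAlgebra.contractLeft d (ExteriorAlgebra.map p y) =
      ExteriorAlgebra.map p (CliffordAlgebra.contractLeft (d ∘ₗ p) y) := by
  induction y using CliffordAlgebra.left_induction with
  | algebraMap r =>
    rw [AlgHom.commutes, CliffordAlgebra.contractLeft_algebraMap,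
      CliffordAlgebra.contractLeft_algebraMap, map_zero]
  | add a b ha hb => simp only [map_add, ha, hb]
  | ι_mul a v ha =>
    have hι : ExteriorAlgebra.map p (CliffordAlgebra.ι 0 v) = CliffordAlgebra.ι 0 (p v) :=
      ExteriorAlgebra.map_apply_ι p v
    rw [CliffordAlgebra.contractLeft_ι_mul, map_mul, hι, CliffordAlgebra.contractLeft_ι_mul, ha,
      map_sub, map_mul, map_smul, hι]
    rfl

/-- The algebra endomorphism that replaces the odd coordinate `g` by the linear form `w g`. -/
def subst (w : Gen → Gen → ℂ) : Grassmann →ₐ[ℂ] Grassmann :=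
  ExteriorAlgebra.map ((Pi.basisFun ℂ Gen).constr ℂ w)

lemma subst_ι_single (w : Gen → Gen → ℂ) (g : Gen) :
    subst w (ι ℂ (Pi.single g 1)) = ι ℂ (w g) := by
  rw [subst, ExteriorAlgebra.map_apply_ι, ← Pi.basisFun_apply, Module.Basis.constr_basis]

lemma oddDeriv_subst {w : Gen → Gen → ℂ} {g : Gen}
    (hw : ∀ g', w g' g = (Pi.single g' 1 : Gen → ℂ) g) (y : Grassmann) :
    oddDeriv g (subst w y) = subst w (oddDeriv g y) := by
  rw [oddDeriv, subst, contractLeft_map]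
  congr 3
  refine (Pi.basisFun ℂ Gen).ext fun g' => ?_
  rw [LinearMap.comp_apply, Module.Basis.constr_basis, Pi.basisFun_apply]
  exact hw g'

lemma oddDeriv_subst_of_covD {w : Gen → Gen → ℂ} {i : Fin 3} {a : Fin 2} {G : Superfield}
    {x : Config} (hw : ∀ g', w g' (Sum.inl (i, a)) = (Pi.single g' 1 : Gen → ℂ) (Sum.inl (i, a)))
    (h0 : ∀ b, w (Sum.inr (i, b)) = 0) (h : covD i a G x = 0) :
    oddDeriv (Sum.inl (i, a)) (subst w (G x)) = 0 := by
  have := congrArg (subst w) h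
  simpa only [covD, map_sub, map_smul, map_sum, map_mul, θbar, subst_ι_single, h0, map_zero,
    zero_mul, smul_zero, Finset.sum_const_zero, sub_zero, ← oddDeriv_subst hw] using this

lemma oddDeriv_subst_of_covDbar {w : Gen → Gen → ℂ} {i : Fin 3} {b : Fin 2} {G : Superfield}
    {x : Config} (hw : ∀ g', w g' (Sum.inr (i, b)) = (Pi.single g' 1 : Gen → ℂ) (Sum.inr (i, b)))
    (h0 : ∀ a, w (Sum.inl (i, a)) = 0) (h : covDbar i b G x = 0) :
    oddDeriv (Sum.inr (i, b)) (subst w (G x)) = 0 := by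
  have := congrArg (subst w) h
  simpa only [covDbar, map_add, map_neg, map_smul, map_sum, map_mul, θ, subst_ι_single, h0,
    map_zero, zero_mul, smul_zero, Finset.sum_const_zero, add_zero, ← oddDeriv_subst hw,
    neg_eq_zero] using this

lemma subst_mem_even (w : Gen → Gen → ℂ) (r : EvenGrassmann) :
    subst w (val r) ∈ CliffordAlgebra.even (0 : QuadraticForm ℂ (Gen → ℂ)) := by
  obtain ⟨r, hr⟩ := r
  change subst w r ∈ _
  induction r, hr using CliffordAlgebra.even_induction with
  | algebraMap z => exact (AlgHom.commutes (subst w) z).symm ▸ Subalgebra.algebraMap_mem _ z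
  | add a b _ _ ha hb => exact map_add (subst w) a b ▸ add_mem ha hb
  | ι_mul_ι_mul v v' a _ ha =>
    rw [map_mul, map_mul]
    refine mul_mem ?_ ha
    have hι : ∀ u, subst w (CliffordAlgebra.ι 0 u) = ι ℂ ((Pi.basisFun ℂ Gen).constr ℂ w u) :=
      ExteriorAlgebra.map_apply_ι _
    rw [hι, hι]
    exact CliffordAlgebra.ι_mul_ι_mem_evenOdd_zero _ _ _

/-- The restriction of `subst w` to even elements. -/
def evenSubst (w : Gen → Gen → ℂ) : EvenGrassmann →ₐ[ℂ] EvenGrassmann :=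
  ((subst w).comp val).codRestrict _ (subst_mem_even w)

lemma val_evenSubst (w : Gen → Gen → ℂ) (r : EvenGrassmann) :
    val (evenSubst w r) = subst w (val r) := rfl

lemma evenSubst_pair (w : Gen → Gen → ℂ) (j : Fin 3) (d : Fin 2) (i : Fin 3) (c : Fin 2) :
    evenSubst w (pair j d i c) =
      EvenGrassmann.ofVectors (w (Sum.inl (j, d))) (w (Sum.inr (i, c))) := by
  refine EvenGrassmann.val_injective ?_
  rw [val_evenSubst, val_pair, map_mul, θ, θbar, subst_ι_single, subst_ι_single,
    EvenGrassmann.val_ofVectors]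

end Substitutions

section FirstOrder

variable {A : Type*} [CommRing A] [Algebra ℂ A]

lemma truncEval_three (f : PowerSeries ℂ) (N : A) :
    truncEval 3 f N = algebraMap ℂ A (f.coeff 0) + f.coeff 1 • N + f.coeff 2 • N ^ 2 := by
  rw [truncEval_eq_sum, Finset.sum_range_succ, Finset.sum_range_succ, Finset.sum_range_one,
    pow_zero, pow_one, Algebra.algebraMap_eq_smul_one]

lemma complexPow_exp_smul_one_add {ε : A} (hε : ε * ε = 0) {n : ℕ} (hn : 2 ≤ n) (L a : ℂ) :
    complexPow n L a (Complex.exp L • (1 + ε)) = Complex.exp (a * L) • (1 + a • ε) := by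
  rw [complexPow, smul_smul, ← Complex.exp_add, neg_add_cancel, Complex.exp_zero, one_smul,
    add_sub_cancel_left, binomialPow, truncEval_of_le hn (by rw [pow_two, hε]), truncEval_eq_sum]
  simp [Finset.sum_range_succ]

lemma truncEval_mul_of_mul_self_eq_zero {e₁ e₂ : A} (h₁ : e₁ * e₁ = 0) (h₂ : e₂ * e₂ = 0)
    (f : PowerSeries ℂ) (s₁ s₂ a₁ a₂ : ℂ) :
    truncEval 3 f ((1 + s₁ • e₁) * (1 + s₂ • e₂) - 1) * ((1 + a₁ • e₁) * (1 + a₂ • e₂)) =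
      algebraMap ℂ A (f.coeff 0) + (s₁ * f.coeff 1 + a₁ * f.coeff 0) • e₁ +
        (s₂ * f.coeff 1 + a₂ * f.coeff 0) • e₂ +
        (s₁ * s₂ * (f.coeff 1 + 2 * f.coeff 2) + (s₁ * a₂ + s₂ * a₁) * f.coeff 1 +
          a₁ * a₂ * f.coeff 0) • (e₁ * e₂) := by
  have hsq : ((1 + s₁ • e₁) * (1 + s₂ • e₂) - 1) ^ 2 = (2 * s₁ * s₂) • (e₁ * e₂) := by
    simp only [Algebra.smul_def, map_mul, map_ofNat]
    set S₁ := algebraMap ℂ A s₁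
    set S₂ := algebraMap ℂ A s₂
    linear_combination S₁ ^ 2 * (1 + S₂ * e₂) ^ 2 * h₁ + S₂ ^ 2 * (1 + 2 * S₁ * e₁) * h₂
  rw [truncEval_three, hsq]
  simp only [Algebra.smul_def, map_mul, map_add, map_ofNat]
  set S₁ := algebraMap ℂ A s₁
  set S₂ := algebraMap ℂ A s₂
  set F₁ := algebraMap ℂ A (f.coeff 1)
  set F₂ := algebraMap ℂ A (f.coeff 2)
  set T₁ := algebraMap ℂ A a₁
  set T₂ := algebraMap ℂ A a₂
  linear_combination
    S₁ * T₁ * (1 + T₂ * e₂) * (F₁ + S₂ * e₂ * (F₁ + 2 * F₂)) * h₁ +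
      S₂ * T₂ * (F₁ * (1 + T₁ * e₁) + S₁ * e₁ * (F₁ + 2 * F₂)) * h₂

end FirstOrder

section MonomialSubstitutions

variable {A : Type*} [CommRing A] [Algebra ℂ A] (φ : EvenGrassmann →ₐ[ℂ] A) {x : Config}

lemma map_intervalMatrix_apply {i j : Fin 3} (h : ∀ i d c, φ (pair i d i c) = 0) (c d : Fin 2) :
    φ.mapMatrix (intervalMatrix i j x) c d =
      algebraMap ℂ A (bodyMatrix i j x c d) - (4 * Complex.I) • φ (pair j d i c) := by
  rw [AlgHom.mapMatrix_apply, Matrix.map_apply, intervalMatrix_apply]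
  simp only [map_add, map_sub, map_smul, h, AlgHom.commutes]
  module

lemma map_intervalDet_of_column {i j : Fin 3} (h : ∀ i d c, φ (pair i d i c) = 0) (k : Fin 2)
    {p : Fin 2 → A} (hp : ∀ c d, φ (pair j d i c) = bodyMatrix i j x c k • p d) :
    φ (intervalDet i j x) = bodySq i j x • (1 - (4 * Complex.I) • p k) := by
  rw [intervalDet, AlgHom.map_det, Matrix.det_fin_two, ← det_bodyMatrix, Matrix.det_fin_two]
  simp only [map_intervalMatrix_apply φ h, hp, Algebra.smul_def, map_mul, map_sub]
  fin_cases k <;> simp only [Fin.zero_eta, Fin.mk_one] <;> ring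

lemma map_intervalDet_of_row {i j : Fin 3} (h : ∀ i d c, φ (pair i d i c) = 0) (k : Fin 2)
    {p : Fin 2 → A} (hp : ∀ c d, φ (pair j d i c) = bodyMatrix i j x k d • p c) :
    φ (intervalDet i j x) = bodySq i j x • (1 - (4 * Complex.I) • p k) := by
  rw [intervalDet, AlgHom.map_det, Matrix.det_fin_two, ← det_bodyMatrix, Matrix.det_fin_two]
  simp only [map_intervalMatrix_apply φ h, hp, Algebra.smul_def, map_mul, map_sub]
  fin_cases k <;> simp only [Fin.zero_eta, Fin.mk_one] <;> ring

variable {L : Fin 3 → Fin 3 → ℂ} {ε : Fin 3 → Fin 3 → A} {φ}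

lemma IsLogAt.map_intervalMonomial (hL : IsLogAt x L) (hε : ∀ i j, ε i j * ε i j = 0)
    (hφ : ∀ i j, i ≠ j → φ (intervalDet i j x) = bodySq i j x • (1 + ε i j))
    (e : Matrix (Fin 3) (Fin 3) ℂ) :
    φ (intervalMonomial L e x) = Complex.exp (∑ p ∈ Finset.univ.offDiag, e p.1 p.2 * L p.1 p.2) •
      ∏ p ∈ Finset.univ.offDiag, (1 + e p.1 p.2 • ε p.1 p.2) := by
  rw [Complex.exp_sum, ← Finset.prod_smul, intervalMonomial, map_prod]
  refine Finset.prod_congr rfl fun p hp => ?_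
  have hne := (Finset.mem_offDiag.1 hp).2.2
  rw [map_complexPow, hφ _ _ hne, ← hL.exp_eq _ _ hne,
    complexPow_exp_smul_one_add (hε _ _) (by decide)]

end MonomialSubstitutions

section Charts

variable {ℓ : Fin 3 → Fin 3 → Config → ℂ} {x : Config}

lemma IsLogAt.exists_map_generalThreePoint {L : Fin 3 → Fin 3 → ℂ} (hL : IsLogAt x L)
    {A : Type*} [CommRing A] [Algebra ℂ A] {φ : EvenGrassmann →ₐ[ℂ] A} {ε : Fin 3 → Fin 3 → A}
    (hε : ∀ i j, ε i j * ε i j = 0)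
    (hφ : ∀ i j, i ≠ j → φ (intervalDet i j x) = bodySq i j x • (1 + ε i j))
    (f : PowerSeries ℂ) (e : Matrix (Fin 3) (Fin 3) ℂ) :
    ∃ K : ℂ, K ≠ 0 ∧
      φ (truncEval 3 f (intervalMonomial L crossExponent x - 1) * intervalMonomial L e x) =
        K • (truncEval 3 f
            (∏ p ∈ Finset.univ.offDiag, (1 + crossExponent p.1 p.2 • ε p.1 p.2) - 1) *
          ∏ p ∈ Finset.univ.offDiag, (1 + e p.1 p.2 • ε p.1 p.2)) := by
  refine ⟨_, Complex.exp_ne_zero (∑ p ∈ Finset.univ.offDiag, e p.1 p.2 * L p.1 p.2), ?_⟩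
  rw [map_mul, map_truncEval, map_sub, map_one, hL.map_intervalMonomial hε hφ,
    hL.map_intervalMonomial hε hφ, hL.sum_crossExponent_mul, Complex.exp_zero, one_smul,
    mul_smul_comm]

lemma ofVectors_mul_self_right (v v' w : Gen → ℂ) :
    EvenGrassmann.ofVectors v w * EvenGrassmann.ofVectors v' w = 0 := by
  refine EvenGrassmann.val_injective ?_
  rw [map_mul, map_zero, EvenGrassmann.val_ofVectors v', ← EvenGrassmann.mul_val_mul,
    EvenGrassmann.val_ofVectors, mul_assoc, ExteriorAlgebra.ι_sq_zero, mul_zero, mul_zero]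

lemma oddDeriv_val_mul (g : Gen) (r s : EvenGrassmann) :
    oddDeriv g (val (r * s)) = oddDeriv g (val r) * val s + val r * oddDeriv g (val s) := by
  rw [map_mul]
  exact contractLeft_even_mul _ r.val_mem_even _

lemma oddDeriv_val_ofVectors (g : Gen) (v w : Gen → ℂ) :
    oddDeriv g (val (EvenGrassmann.ofVectors v w)) =
      v g • ExteriorAlgebra.ι ℂ w - w g • ExteriorAlgebra.ι ℂ v := by
  refine (CliffordAlgebra.contractLeft_ι_mul _ _ _).trans ?_
  rw [Algebra.smul_def (w g), Algebra.commutes]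
  exact congrArg (_ - _ * ·) (CliffordAlgebra.contractLeft_ι _ _ _)

lemma eq_zero_of_oddDeriv_add_ofVectors_mul {g g' : Gen} (hg : g ≠ g') {r s : EvenGrassmann}
    (hr : oddDeriv g (val r) = 0) (hs : oddDeriv g (val s) = 0) (hs' : oddDeriv g' (val s) = 0)
    (h : oddDeriv g (val
      (r + EvenGrassmann.ofVectors (Pi.single g 1) (Pi.single g' 1) * s)) = 0) : s = 0 := by
  rw [map_add, map_add, hr, zero_add, oddDeriv_val_mul, hs, mul_zero, add_zero,
    oddDeriv_val_ofVectors, Pi.single_eq_same, Pi.single_eq_of_ne hg, one_smul, zero_smul,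
    sub_zero] at h
  have h' := congrArg (oddDeriv g') h
  rw [map_zero] at h'
  refine EvenGrassmann.val_injective ?_
  calc val s = (Pi.single g' 1 : Gen → ℂ) g' • val s -
        ExteriorAlgebra.ι ℂ (Pi.single g' 1) * oddDeriv g' (val s) := by
        rw [Pi.single_eq_same, one_smul, hs', mul_zero, sub_zero]
    _ = oddDeriv g' (ExteriorAlgebra.ι ℂ (Pi.single g' 1) * val s) :=
        (CliffordAlgebra.contractLeft_ι_mul _ _ _).symm
    _ = val 0 := h'.trans (map_zero val).symm

lemma oddDeriv_val_algebraMap (g : Gen) (z : ℂ) :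
    oddDeriv g (val (algebraMap ℂ EvenGrassmann z)) = 0 := by
  rw [AlgHom.commutes]
  exact CliffordAlgebra.contractLeft_algebraMap _ _ _

/-- The substitution that keeps `θ_0` and makes each `θbar_i` proportional to a single odd
coordinate, in such a way that the square `(x_{ībar 0})²` depends on the component `r i` of `θ_0`
only. In particular it annihilates `θbar_0`. -/
def antichiralChart (x : Config) (r : Fin 3 → Fin 2) : Gen → Gen → ℂ :=
  Sum.elim (fun p => if p.1 = 0 then Pi.single (Sum.inl p) 1 else 0)
    (fun p => bodyMatrix p.1 0 x p.2 (r p.1) • Pi.single (Sum.inr (p.1, 0)) 1)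

lemma evenSubst_antichiralChart_pair (x : Config) (r : Fin 3 → Fin 2) (j : Fin 3) (d : Fin 2)
    (i : Fin 3) (c : Fin 2) : evenSubst (antichiralChart x r) (pair j d i c) =
      bodyMatrix i 0 x c (r i) • (if j = 0 then pair 0 d i 0 else 0) := by
  refine EvenGrassmann.val_injective ?_
  rw [evenSubst_pair, EvenGrassmann.val_ofVectors]
  split_ifs with hj
  · simp [antichiralChart, hj, val_pair, θ, θbar]
  · simp [antichiralChart, hj]

/-- The nilpotent parts of the squares under `antichiralChart`. -/
def antichiralNil (r : Fin 3 → Fin 2) (i j : Fin 3) : EvenGrassmann :=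
  if j = 0 then -(4 * Complex.I) • pair 0 (r i) i 0 else 0

lemma antichiralNil_mul_self (r : Fin 3 → Fin 2) (i j : Fin 3) :
    antichiralNil r i j * antichiralNil r i j = 0 := by
  rw [antichiralNil]
  split_ifs
  · rw [smul_mul_smul_comm, pair, ofVectors_mul_self_right, smul_zero]
  · exact mul_zero 0

lemma evenSubst_antichiralChart_intervalDet (x : Config) (r : Fin 3 → Fin 2) (i j : Fin 3) :
    evenSubst (antichiralChart x r) (intervalDet i j x) =
      bodySq i j x • (1 + antichiralNil r i j) := by
  rw [map_intervalDet_of_column _ (k := r i) (p := fun d => if j = 0 then pair 0 d i 0 else 0)]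
  · rw [antichiralNil]
    split_ifs
    · rw [neg_smul, sub_eq_add_neg]
    · rw [smul_zero, sub_zero, add_zero]
  · intro i d c
    rw [evenSubst_antichiralChart_pair]
    split_ifs with hi
    · rw [hi, bodyMatrix_self, Matrix.zero_apply, zero_smul]
    · rw [smul_zero]
  · intro c d
    rw [evenSubst_antichiralChart_pair]
    split_ifs with hj
    · rw [hj]
    · rw [smul_zero, smul_zero]

lemma oddDeriv_subst_antichiralChart_of_covD (r : Fin 3 → Fin 2) {s : Fin 2} {G : Superfield}
    (h : covD 0 s G x = 0) :
    oddDeriv (Sum.inl (0, s)) (subst (antichiralChart x r) (G x)) = 0 := by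
  refine oddDeriv_subst_of_covD (fun g' => ?_) (fun b => ?_) h
  · rcases g' with ⟨i, a⟩ | ⟨i, a⟩
    · fin_cases i <;> simp [antichiralChart, Pi.single_apply]
    · simp [antichiralChart]
  · simp [antichiralChart, bodyMatrix_self]

lemma eq_zero_of_oddDeriv_pair_polynomial {y : EvenGrassmann} {z₀ z₁ z₂ z₃ : ℂ}
    (hy : y = algebraMap ℂ EvenGrassmann z₀ + z₁ • pair 0 0 1 0 + z₂ • pair 0 1 2 0 +
      z₃ • (pair 0 0 1 0 * pair 0 1 2 0)) (h : ∀ s, oddDeriv (Sum.inl (0, s)) (val y) = 0) :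
    z₁ = 0 ∧ z₂ = 0 ∧ z₃ = 0 := by
  have hp : oddDeriv (Sum.inl (0, 1)) (val (pair 0 0 1 0)) = 0 := by
    simp [pair, oddDeriv_val_ofVectors]
  have hq : ∀ g, g = Sum.inl (0, 0) ∨ g = Sum.inr (1, 0) → ∀ z w : ℂ,
      oddDeriv g (val (algebraMap ℂ EvenGrassmann z + w • pair 0 1 2 0)) = 0 := by
    rintro _ (rfl | rfl) z w <;> rw [map_add, map_add, oddDeriv_val_algebraMap] <;>
      simp [pair, oddDeriv_val_ofVectors]
  have hz : ∀ z : ℂ, algebraMap ℂ EvenGrassmann z = 0 → z = 0 := fun z =>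
    (map_eq_zero_iff _ (algebraMap ℂ EvenGrassmann).injective).1
  have h₁₃ : algebraMap ℂ EvenGrassmann z₁ + z₃ • pair 0 1 2 0 = 0 := by
    refine eq_zero_of_oddDeriv_add_ofVectors_mul (g := Sum.inl (0, 0)) (g' := Sum.inr (1, 0))
      (r := algebraMap ℂ EvenGrassmann z₀ + z₂ • pair 0 1 2 0) (by decide)
      (hq _ (.inl rfl) z₀ z₂) (hq _ (.inl rfl) z₁ z₃) (hq _ (.inr rfl) z₁ z₃) ?_
    convert h 0 using 3
    rw [hy]
    simp only [Algebra.smul_def, pair]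
    ring
  have h₃ : z₃ = 0 := hz z₃ <| by
    refine eq_zero_of_oddDeriv_add_ofVectors_mul (g := Sum.inl (0, 1)) (g' := Sum.inr (2, 0))
      (r := algebraMap ℂ EvenGrassmann z₁) (by decide) (oddDeriv_val_algebraMap _ _)
      (oddDeriv_val_algebraMap _ _) (oddDeriv_val_algebraMap _ _) ?_
    rw [mul_comm, ← Algebra.smul_def]
    exact h₁₃ ▸ map_zero ((oddDeriv _).comp val.toLinearMap)
  have h₂ : z₂ = 0 := hz z₂ <| by
    refine eq_zero_of_oddDeriv_add_ofVectors_mul (g := Sum.inl (0, 1)) (g' := Sum.inr (2, 0))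
      (r := algebraMap ℂ EvenGrassmann z₀ + z₁ • pair 0 0 1 0) (by decide) ?_
      (oddDeriv_val_algebraMap _ _) (oddDeriv_val_algebraMap _ _) ?_
    · simp only [map_add, map_smul, oddDeriv_val_algebraMap, hp, smul_zero, add_zero]
    · convert h 1 using 3
      rw [hy, h₃, zero_smul, add_zero, mul_comm, ← Algebra.smul_def, pair]
      rfl
  rw [h₃, zero_smul, add_zero] at h₁₃
  exact ⟨hz z₁ h₁₃, h₂, h₃⟩

lemma coeff_eq_of_covD_generalThreePoint (hL : IsLogAt x fun i j => ℓ i j x) {η κ : Fin 3 → ℝ}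
    {f : PowerSeries ℂ} (h : ∀ s, covD 0 s (generalThreePoint ℓ η κ f) x = 0) :
    f.coeff 1 = -Δ η κ 1 0 * f.coeff 0 ∧ f.coeff 1 = Δ η κ 2 0 * f.coeff 0 ∧
      2 * f.coeff 2 = (-Δ η κ 1 0 - 1) * f.coeff 1 := by
  set r : Fin 3 → Fin 2 := ![0, 0, 1]
  obtain ⟨K, hK, hG⟩ := hL.exists_map_generalThreePoint (antichiralNil_mul_self r)
    (fun i j _ => evenSubst_antichiralChart_intervalDet x r i j) f (-scalingExponent η κ)
  have hprod : ∀ e : Matrix (Fin 3) (Fin 3) ℂ,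
      ∏ p ∈ Finset.univ.offDiag, (1 + e p.1 p.2 • antichiralNil r p.1 p.2) =
        (1 + e 1 0 • antichiralNil r 1 0) * (1 + e 2 0 • antichiralNil r 2 0) := fun e => by
    simp [prod_offDiag_fin_three, antichiralNil]
  rw [hprod, hprod, truncEval_mul_of_mul_self_eq_zero (antichiralNil_mul_self r _ _)
    (antichiralNil_mul_self r _ _)] at hG
  have hd := fun s => oddDeriv_subst_antichiralChart_of_covD r (h s)
  simp only [generalThreePoint_eq hL, ← val_evenSubst, hG, map_smul, smul_eq_zero, hK,
    false_or] at hd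
  have hpair : ∀ i, antichiralNil r i 0 = -(4 * Complex.I) • pair 0 (r i) i 0 := fun _ => if_pos rfl
  simp only [hpair, smul_smul, smul_mul_smul_comm] at hd
  obtain ⟨h₁, h₂, h₃⟩ := eq_zero_of_oddDeriv_pair_polynomial rfl hd
  have hI : -(4 * Complex.I) ≠ 0 :=
    neg_ne_zero.2 (mul_ne_zero (by norm_num) Complex.I_ne_zero)
  replace h₁ := (mul_eq_zero.1 h₁).resolve_right hI
  replace h₂ := (mul_eq_zero.1 h₂).resolve_right hI
  replace h₃ := (mul_eq_zero.1 h₃).resolve_right (mul_ne_zero hI hI)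
  simp only [crossExponent, scalingExponent, Matrix.neg_apply, Matrix.of_apply,
    Matrix.cons_val] at h₁ h₂ h₃
  refine ⟨by linear_combination -h₁, by linear_combination h₂, ?_⟩
  linear_combination -h₃ - Δ η κ 2 0 * h₁

lemma ofVectors_swap (v w : Gen → ℂ) :
    EvenGrassmann.ofVectors v w = -EvenGrassmann.ofVectors w v := by
  refine EvenGrassmann.val_injective ?_
  rw [map_neg, EvenGrassmann.val_ofVectors, EvenGrassmann.val_ofVectors, ι_mul_ι_anticomm]

/-- The substitution that keeps `θbar_k^0`, replaces `θ_l` by a multiple of `θ_l^0` in such a way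
that `(x_{kbar l})²` depends on `θbar_k^0`, and annihilates the other odd coordinates. -/
def chiralChart (x : Config) (k l : Fin 3) : Gen → Gen → ℂ :=
  Sum.elim (fun p => if p.1 = l then bodyMatrix k l x 0 p.2 • Pi.single (Sum.inl (l, 0)) 1 else 0)
    (fun p => if p = (k, 0) then Pi.single (Sum.inr p) 1 else 0)

/-- The nilpotent parts of the squares under `chiralChart`. -/
def chiralNil (k l i j : Fin 3) : EvenGrassmann :=
  if i = k ∧ j = l then -(4 * Complex.I) • pair l 0 k 0 else 0

lemma chiralNil_mul_self (k l i j : Fin 3) : chiralNil k l i j * chiralNil k l i j = 0 := by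
  rw [chiralNil]
  split_ifs
  · rw [smul_mul_smul_comm, pair, ofVectors_mul_self_right, smul_zero]
  · exact mul_zero 0

lemma evenSubst_chiralChart_pair (x : Config) (k l j : Fin 3) (d : Fin 2) (i : Fin 3)
    (c : Fin 2) : evenSubst (chiralChart x k l) (pair j d i c) =
      bodyMatrix k l x 0 d • (if (i = k ∧ j = l) ∧ c = 0 then pair l 0 k 0 else 0) := by
  refine EvenGrassmann.val_injective ?_
  rw [evenSubst_pair, EvenGrassmann.val_ofVectors]
  split_ifs with h
  · obtain ⟨⟨rfl, rfl⟩, rfl⟩ := h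
    simp [chiralChart, val_pair, θ, θbar]
  · by_cases hj : j = l
    · have hi : ¬(i = k ∧ c = 0) := fun h' => h ⟨⟨h'.1, hj⟩, h'.2⟩
      simp [chiralChart, hi]
    · simp [chiralChart, hj]

lemma evenSubst_chiralChart_intervalDet (x : Config) {k l : Fin 3} (hkl : k ≠ l) (i j : Fin 3) :
    evenSubst (chiralChart x k l) (intervalDet i j x) =
      bodySq i j x • (1 + chiralNil k l i j) := by
  rw [map_intervalDet_of_row _ (k := 0)
    (p := fun c => if (i = k ∧ j = l) ∧ c = 0 then pair l 0 k 0 else 0)]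
  · simp only [chiralNil, and_true]
    split_ifs
    · rw [neg_smul, sub_eq_add_neg]
    · rw [smul_zero, sub_zero, add_zero]
  · intro i d c
    rw [evenSubst_chiralChart_pair, if_neg (fun h => hkl (h.1.1.symm.trans h.1.2)), smul_zero]
  · intro c d
    rw [evenSubst_chiralChart_pair]
    split_ifs with h
    · rw [h.1.1, h.1.2]
    · rw [smul_zero, smul_zero]

lemma oddDeriv_subst_chiralChart_of_covDbar {k l : Fin 3} (hkl : k ≠ l) {G : Superfield}
    (h : covDbar k 0 G x = 0) :
    oddDeriv (Sum.inr (k, 0)) (subst (chiralChart x k l) (G x)) = 0 := by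
  refine oddDeriv_subst_of_covDbar (fun g' => ?_) (fun a => if_neg hkl) h
  rcases g' with p | p
  · by_cases hp : p.1 = l <;> simp [chiralChart, hp]
  · by_cases hp : p = (k, 0)
    · simp [chiralChart, hp]
    · simp [chiralChart, hp, Ne.symm hp]

lemma crossExponent_mul_coeff_eq_of_covDbar_generalThreePoint
    (hL : IsLogAt x fun i j => ℓ i j x) {η κ : Fin 3 → ℝ} {f : PowerSeries ℂ} {k l : Fin 3}
    (hkl : k ≠ l) (h : covDbar k 0 (generalThreePoint ℓ η κ f) x = 0) :
    crossExponent k l * f.coeff 1 = Δ η κ k l * f.coeff 0 := by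
  obtain ⟨K, hK, hG⟩ := hL.exists_map_generalThreePoint (chiralNil_mul_self k l)
    (fun i j _ => evenSubst_chiralChart_intervalDet x hkl i j) f (-scalingExponent η κ)
  have hprod : ∀ e : Matrix (Fin 3) (Fin 3) ℂ,
      ∏ p ∈ Finset.univ.offDiag, (1 + e p.1 p.2 • chiralNil k l p.1 p.2) =
        (1 + e k l • chiralNil k l k l) * (1 + (0 : ℂ) • 0) := fun e => by
    rw [smul_zero, add_zero, mul_one]
    refine Finset.prod_eq_single_of_mem (k, l) (by simp [hkl]) fun p _ hp => ?_
    rw [chiralNil, if_neg fun h => hp (Prod.ext h.1 h.2), smul_zero, add_zero]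
  rw [hprod, hprod, truncEval_mul_of_mul_self_eq_zero (chiralNil_mul_self k l _ _)
    (mul_zero 0), smul_zero, mul_zero (chiralNil k l k l), smul_zero, add_zero, add_zero] at hG
  have hd := oddDeriv_subst_chiralChart_of_covDbar hkl h
  rw [generalThreePoint_eq hL, ← val_evenSubst, hG, map_smul, map_smul, smul_eq_zero,
    or_iff_right hK, chiralNil, if_pos ⟨rfl, rfl⟩, pair, ofVectors_swap, smul_neg, neg_smul,
    neg_neg, smul_smul, Algebra.smul_def, mul_comm] at hd
  have := eq_zero_of_oddDeriv_add_ofVectors_mul (by simp) (oddDeriv_val_algebraMap _ _)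
    (oddDeriv_val_algebraMap _ _) (oddDeriv_val_algebraMap _ _) hd
  rw [map_eq_zero_iff _ (algebraMap ℂ EvenGrassmann).injective] at this
  replace this := (mul_eq_zero.1 this).resolve_right
    (mul_ne_zero (by norm_num) Complex.I_ne_zero)
  rw [Matrix.neg_apply, scalingExponent, Matrix.of_apply] at this
  linear_combination this

end Charts

section Exponents

lemma succ_mul_choose_succ (a : ℂ) (k : ℕ) :
    (k + 1) * Ring.choose a (k + 1) = (a - k) * Ring.choose a k := by
  have h := Ring.choose_smul_choose a (Nat.le_succ k)
  rwa [Nat.succ_eq_add_one, Nat.choose_succ_self_right, Nat.add_sub_cancel_left,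
    Ring.choose_one_right, nsmul_eq_mul, Nat.cast_add_one, mul_comm (Ring.choose a k)] at h

lemma truncEval_three_eq_smul_binomialPow {A : Type*} [CommRing A] [Algebra ℂ A]
    {f : PowerSeries ℂ} {a : ℂ} (h₁ : f.coeff 1 = a * f.coeff 0)
    (h₂ : 2 * f.coeff 2 = (a - 1) * f.coeff 1) (N : A) :
    truncEval 3 f N = f.coeff 0 • binomialPow 3 a N := by
  have hchoose : 2 * Ring.choose a 2 = (a - 1) * a := by
    simpa [one_add_one_eq_two] using succ_mul_choose_succ a 1
  have h₂' : f.coeff 2 = f.coeff 0 * Ring.choose a 2 := by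
    linear_combination (h₂ + (a - 1) * h₁ - f.coeff 0 * hchoose) / 2
  simp only [binomialPow, truncEval_three, PowerSeries.binomialSeries_coeff, Ring.choose_zero_right,
    Ring.choose_one_right, h₁, h₂', smul_add, smul_smul, smul_eq_mul, mul_one, map_one,
    one_mul, Algebra.algebraMap_eq_smul_one, mul_comm a]

variable {η κ : Fin 3 → ℝ}

lemma chiralCharges_of_exponents (hκ : ∑ i, κ i = 0) (h₂₀ : Δ η κ 2 0 = -Δ η κ 1 0)
    (h₁₂ : Δ η κ 1 2 = -Δ η κ 1 0) (h₂₁ : Δ η κ 2 1 = Δ η κ 1 0) : ChiralCharges η κ := by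
  simp only [Δ, Fin.sum_univ_three] at *
  refine ⟨?_, ?_, ?_⟩ <;> linarith

lemma ChiralCharges.eta_eq (h : ChiralCharges η κ) (hκ : ∑ i, κ i = 0) : η 0 = η 1 + η 2 := by
  obtain ⟨h₀, h₁, h₂⟩ := h
  rw [Fin.sum_univ_three] at hκ
  linarith

lemma ChiralCharges.exponents_eq (h : ChiralCharges η κ) (hκ : ∑ i, κ i = 0) {i j : Fin 3}
    (hij : i ≠ j) : ((-Δ η κ 1 0 : ℂ) • crossExponent + -scalingExponent η κ) i j =
      (-(Matrix.single 0 1 (η 1 : ℂ) + Matrix.single 0 2 (η 2 : ℂ)) : Matrix _ _ ℂ) i j := by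
  have hη := h.eta_eq hκ
  obtain ⟨h₀, h₁, h₂⟩ := h
  fin_cases i <;> fin_cases j <;>
    simp [scalingExponent, crossExponent, Δ, Fin.sum_univ_three, h₀, h₁, h₂, hη] at hij ⊢ <;> ring

variable {ℓ : Fin 3 → Fin 3 → Config → ℂ} {x : Config} (hL : IsLogAt x fun i j => ℓ i j x)
include hL

lemma taylorEval_I3PF_eq_smul_gpow {f : PowerSeries ℂ} {a : ℂ} (h₁ : f.coeff 1 = a * f.coeff 0)
    (h₂ : 2 * f.coeff 2 = (a - 1) * f.coeff 1) :
    taylorEval f (I3PF x) = f.coeff 0 • gpow 0 a (I3PF x + 1) := by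
  have hgpow : gpow 0 a (I3PF x + 1) = taylorEval (PowerSeries.binomialSeries ℂ a) (I3PF x) := by
    simp [gpow]
  rw [hgpow, hL.taylorEval_I3PF, hL.taylorEval_I3PF, truncEval_three_eq_smul_binomialPow h₁ h₂,
    map_smul, binomialPow]

lemma generalThreePoint_eq_smul_chiralThreePoint {f : PowerSeries ℂ} {C : ℂ}
    (hf : taylorEval f (I3PF x) = C • gpow 0 (-Δ η κ 1 0) (I3PF x + 1)) (hκ : ∑ i, κ i = 0)
    (hC : C ≠ 0 → ChiralCharges η κ) :
    generalThreePoint ℓ η κ f x = C • chiralThreePoint ℓ η x := by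
  rcases eq_or_ne C 0 with rfl | hC₀
  · rw [generalThreePoint, hf, zero_smul, zero_mul, zero_smul]
  · rw [generalThreePoint_eq hL, chiralThreePoint_eq hL, map_mul, ← hL.taylorEval_I3PF, hf,
      hL.gpow_I3PF_add_one, smul_mul_assoc, ← map_mul, ← hL.intervalMonomial_add,
      intervalMonomial_congr fun i j => (hC hC₀).exponents_eq hκ]

variable {f : PowerSeries ℂ} (hA : ∀ s, covD 0 s (generalThreePoint ℓ η κ f) x = 0)
include hA

lemma chiralCharges_of_coeff_zero_ne_zero (hκ : ∑ i, κ i = 0) (hf : f.coeff 0 ≠ 0)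
    (h₁ : covDbar 1 0 (generalThreePoint ℓ η κ f) x = 0)
    (h₂ : covDbar 2 0 (generalThreePoint ℓ η κ f) x = 0) : ChiralCharges η κ := by
  obtain ⟨h₁₀, h₂₀, -⟩ := coeff_eq_of_covD_generalThreePoint hL hA
  have h₁₂ := crossExponent_mul_coeff_eq_of_covDbar_generalThreePoint hL
    (show (1 : Fin 3) ≠ 2 by decide) h₁
  have h₂₁ := crossExponent_mul_coeff_eq_of_covDbar_generalThreePoint hL
    (show (2 : Fin 3) ≠ 1 by decide) h₂
  rw [show crossExponent 1 2 = 1 from rfl] at h₁₂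
  rw [show crossExponent 2 1 = -1 from rfl] at h₂₁
  refine chiralCharges_of_exponents hκ ?_ ?_ ?_ <;>
    refine Complex.ofReal_injective (mul_right_cancel₀ hf ?_)
  · rw [Complex.ofReal_neg, ← h₁₀, h₂₀]
  · rw [Complex.ofReal_neg, ← h₁₀, ← h₁₂, one_mul]
  · rw [← h₂₁, h₁₀, neg_one_mul, neg_mul, neg_neg]

lemma taylorEval_I3PF_of_covD :
    taylorEval f (I3PF x) = f.coeff 0 • gpow 0 (-Δ η κ 1 0) (I3PF x + 1) := by
  obtain ⟨h₁, -, h₂⟩ := coeff_eq_of_covD_generalThreePoint hL hA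
  exact taylorEval_I3PF_eq_smul_gpow hL h₁ h₂

end Exponents

section BinomialDerivative

lemma one_add_X_mul_derivative_binomialSeries (a : ℂ) :
    (1 + PowerSeries.X) * PowerSeries.derivative ℂ (PowerSeries.binomialSeries ℂ a) =
      a • PowerSeries.binomialSeries ℂ a := by
  ext k
  have h := succ_mul_choose_succ a k
  rw [add_mul, one_mul, map_add, PowerSeries.coeff_derivative, PowerSeries.coeff_smul]
  cases k with
  | zero =>
    rw [PowerSeries.coeff_zero_X_mul]
    simp only [PowerSeries.binomialSeries_coeff, smul_eq_mul]
    linear_combination h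
  | succ k =>
    rw [PowerSeries.coeff_succ_X_mul, PowerSeries.coeff_derivative]
    simp only [PowerSeries.binomialSeries_coeff, smul_eq_mul]
    push_cast at h ⊢
    linear_combination h

lemma one_add_mul_aeval_derivative_trunc_binomialSeries {A : Type*} [CommRing A] [Algebra ℂ A]
    {N : A} {n : ℕ} (hN : N ^ n = 0) (a : ℂ) :
    (1 + N) * Polynomial.aeval N (Polynomial.derivative
        ((PowerSeries.binomialSeries ℂ a).trunc (n + 1))) =
      a • binomialPow (n + 1) a N := by
  have hone : truncEval n (1 + PowerSeries.X : PowerSeries ℂ) N = 1 + N := by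
    have h := truncEval_coe hN (1 + Polynomial.X : Polynomial ℂ)
    rwa [Polynomial.coe_add, Polynomial.coe_one, Polynomial.coe_X, map_add, map_one,
      Polynomial.aeval_X] at h
  rw [← PowerSeries.trunc_derivative, ← hone]
  refine (truncEval_mul hN _ _).symm.trans ?_
  rw [one_add_X_mul_derivative_binomialSeries, binomialPow, truncEval_of_le n.le_succ hN, truncEval,
    truncEval, map_smul, map_smul]

end BinomialDerivative

section SuperDerivative

instance : FiniteDimensional ℝ Grassmann :=
  have : FiniteDimensional ℂ Grassmann := Module.Finite.of_basis monomialBasis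
  FiniteDimensional.complexToReal Grassmann

/-- The product of the Grassmann algebra as a continuous bilinear map. -/
def mulBilin : Grassmann →L[ℝ] Grassmann →L[ℝ] Grassmann :=
  LinearMap.toContinuousBilinearMap (LinearMap.mk₂ ℝ (fun y z : Grassmann => y * z) add_mul
    (fun c y z => smul_mul_assoc (c : ℂ) y z) mul_add (fun c y z => mul_smul_comm (c : ℂ) y z))

/-- The operator `∂/∂g + ∑ μ, τ^μ ∂/∂x_i^μ` on superfields, for an odd coordinate `g`. The covariant
derivatives are of this form up to a sign. -/
def superDeriv (g : Gen) (i : Fin 3) (τ : Fin 4 → Grassmann) (Φ : Superfield) : Superfield :=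
  fun x => oddDeriv g (Φ x) + ∑ μ, τ μ * evenDeriv i μ Φ x

/-- The even superfield `r` is differentiable at `x`, where its `superDeriv` is `R`. -/
structure HasSuperDeriv (g : Gen) (i : Fin 3) (τ : Fin 4 → Grassmann) (r : Config → EvenGrassmann)
    (R : Grassmann) (x : Config) : Prop where
  differentiableAt : DifferentiableAt ℝ (fun y => val (r y)) x
  eq : superDeriv g i τ (fun y => val (r y)) x = R

variable {g : Gen} {i : Fin 3} {τ : Fin 4 → Grassmann} {x : Config}

lemma superDeriv_congr {Φ Ψ : Superfield} (h : Φ =ᶠ[nhds x] Ψ) :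
    superDeriv g i τ Φ x = superDeriv g i τ Ψ x := by
  simp only [superDeriv, evenDeriv, h.fderiv_eq, h.eq_of_nhds]

lemma hasSuperDeriv_algebraMap {z : Config → ℂ} {z' : Config →L[ℝ] ℂ} (hz : HasFDerivAt z z' x) :
    HasSuperDeriv g i τ (fun y => algebraMap ℂ EvenGrassmann (z y))
      (∑ μ, z' (Pi.single i (Pi.single μ 1)) • τ μ) x := by
  have heq : (fun y => val (algebraMap ℂ EvenGrassmann (z y))) = fun y => z y • (1 : Grassmann) :=
    funext fun y => (AlgHom.commutes val (z y)).trans (Algebra.algebraMap_eq_smul_one _)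
  have hd := hz.smul_const (1 : Grassmann)
  rw [← heq] at hd
  refine ⟨hd.differentiableAt, ?_⟩
  simp only [superDeriv, evenDeriv, hd.fderiv, oddDeriv_val_algebraMap, zero_add,
    ContinuousLinearMap.smulRight_apply, mul_smul_comm, mul_one]

lemma hasSuperDeriv_const (r : EvenGrassmann) :
    HasSuperDeriv g i τ (fun _ => r) (oddDeriv g (val r)) x := by
  refine ⟨differentiableAt_const _, ?_⟩
  simp only [superDeriv, evenDeriv, fderiv_const_apply, zero_apply, mul_zero,
    Finset.sum_const_zero, add_zero]

namespace HasSuperDeriv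

variable {r s : Config → EvenGrassmann} {R S : Grassmann}

lemma add (hr : HasSuperDeriv g i τ r R x) (hs : HasSuperDeriv g i τ s S x) :
    HasSuperDeriv g i τ (r + s) (R + S) x := by
  have hd := hr.differentiableAt.hasFDerivAt.add hs.differentiableAt.hasFDerivAt
  have heq : (fun y => val (r y)) + (fun y => val (s y)) = fun y => val ((r + s) y) :=
    funext fun y => (map_add val (r y) (s y)).symm
  rw [heq] at hd
  refine ⟨hd.differentiableAt, ?_⟩
  rw [← hr.eq, ← hs.eq]
  calc superDeriv g i τ (fun y => val ((r + s) y)) x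
    _ = (oddDeriv g (val (r x)) + oddDeriv g (val (s x))) +
        ∑ μ, τ μ * (evenDeriv i μ (fun y => val (r y)) x +
          evenDeriv i μ (fun y => val (s y)) x) := by
        rw [superDeriv, Pi.add_apply, map_add, map_add]
        simp only [evenDeriv, hd.fderiv]
        rfl
    _ = _ := by
        simp only [superDeriv, mul_add, Finset.sum_add_distrib]
        abel

lemma mul (hr : HasSuperDeriv g i τ r R x) (hs : HasSuperDeriv g i τ s S x) :
    HasSuperDeriv g i τ (r * s) (R * val (s x) + val (r x) * S) x := by
  have hd := mulBilin.hasFDerivAt_of_bilinear hr.differentiableAt.hasFDerivAt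
    hs.differentiableAt.hasFDerivAt
  have heq : (fun y => mulBilin (val (r y)) (val (s y))) = fun y => val ((r * s) y) :=
    funext fun y => (map_mul val (r y) (s y)).symm
  rw [heq] at hd
  refine ⟨hd.differentiableAt, ?_⟩
  rw [← hr.eq, ← hs.eq]
  calc superDeriv g i τ (fun y => val ((r * s) y)) x
    _ = (oddDeriv g (val (r x)) * val (s x) + val (r x) * oddDeriv g (val (s x))) +
        ∑ μ, τ μ * (val (r x) * evenDeriv i μ (fun y => val (s y)) x +
          evenDeriv i μ (fun y => val (r y)) x * val (s x)) := by
        rw [superDeriv, Pi.mul_apply, oddDeriv_val_mul]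
        simp only [evenDeriv, hd.fderiv]
        rfl
    _ = _ := by
        simp only [superDeriv, mul_add, add_mul, EvenGrassmann.mul_val_mul, Finset.sum_add_distrib,
          Finset.sum_mul, Finset.mul_sum, mul_assoc]
        abel

lemma aeval (hr : HasSuperDeriv g i τ r R x) (p : Polynomial ℂ) :
    HasSuperDeriv g i τ (fun y => Polynomial.aeval (r y) p)
      (val (Polynomial.aeval (r x) (Polynomial.derivative p)) * R) x := by
  induction p using Polynomial.induction_on with
  | C z =>
    simp only [Polynomial.aeval_C, Polynomial.derivative_C, map_zero, zero_mul]
    rw [← oddDeriv_val_algebraMap g z]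
    exact hasSuperDeriv_const _
  | add p q hp hq =>
    simp only [map_add, add_mul]
    exact hp.add hq
  | monomial n z h =>
    rw [pow_succ, ← mul_assoc]
    generalize Polynomial.C z * Polynomial.X ^ n = q at h ⊢
    simp only [Polynomial.derivative_mul, Polynomial.derivative_X, mul_one, map_mul, map_add,
      Polynomial.aeval_X]
    have hmul := h.mul hr
    rwa [mul_assoc _ R, ← EvenGrassmann.val_mul_comm (r x) R, ← mul_assoc, ← add_mul] at hmul

/-- Writing `N = exp (-L) Φ - 1`, one has `D N = -(1 + N) D L`, which the derivative of `exp (a L)`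
compensates because of `(1 + X) ((1 + X) ^ a)' = a (1 + X) ^ a`. -/
lemma complexPow {L : Config → ℂ} (hL : DifferentiableAt ℝ L x) (hr : HasSuperDeriv g i τ r 0 x)
    {n : ℕ} (hN : (Complex.exp (-L x) • r x - 1) ^ n = 0) (a : ℂ) :
    HasSuperDeriv g i τ (fun y => complexPow (n + 1) (L y) a (r y)) 0 x := by
  set Λ : Grassmann := ∑ μ, fderiv ℝ L x (Pi.single i (Pi.single μ 1)) • τ μ
  have hexp : ∀ b : ℂ, HasSuperDeriv g i τ
      (fun y => algebraMap ℂ EvenGrassmann (Complex.exp (b * L y)))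
      ((Complex.exp (b * L x) * b) • Λ) x := fun b => by
    convert hasSuperDeriv_algebraMap (hL.hasFDerivAt.const_mul b).cexp using 1
    simp only [Λ, Finset.smul_sum, smul_smul]
    rfl
  set N : Config → EvenGrassmann := fun y => Complex.exp (-L y) • r y - 1
  have hN' : HasSuperDeriv g i τ N (-(val (1 + N x) * Λ)) x := by
    convert ((hexp (-1)).mul hr).add (hasSuperDeriv_const (-1)) using 1
    · ext1 y
      simp only [N, Pi.add_apply, Pi.mul_apply, neg_one_mul, Algebra.smul_def, sub_eq_add_neg]
    · have hconst : oddDeriv g (val (-1)) = 0 := by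
        simpa only [map_neg, map_one] using oddDeriv_val_algebraMap g (-1)
      simp only [N, hconst, add_sub_cancel, neg_mul, one_mul, mul_neg_one, mul_zero, add_zero,
        map_smul, neg_smul, smul_mul_assoc, EvenGrassmann.val_mul_comm]
  set P := (PowerSeries.binomialSeries ℂ a).trunc (n + 1)
  convert (hexp a).mul (hN'.aeval P) using 1
  · exact funext fun y => Algebra.smul_def _ _
  · have h := congrArg val (one_add_mul_aeval_derivative_trunc_binomialSeries hN a)
    rw [map_smul, mul_comm, map_mul] at h
    rw [mul_neg, ← mul_assoc, h, AlgHom.commutes, mul_neg, ← Algebra.smul_def, smul_mul_assoc,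
      smul_mul_assoc, EvenGrassmann.val_mul_comm, smul_smul]
    exact (add_neg_cancel _).symm

end HasSuperDeriv

/-- The even superfields that are differentiable at `x` and annihilated there by `superDeriv`. -/
def superKernel (g : Gen) (i : Fin 3) (τ : Fin 4 → Grassmann) (x : Config) :
    Subalgebra ℂ (Config → EvenGrassmann) where
  carrier := {r | HasSuperDeriv g i τ r 0 x}
  mul_mem' hr hs := by
    have h := HasSuperDeriv.mul hr hs
    rwa [zero_mul, mul_zero, add_zero] at h
  add_mem' hr hs := by
    have h := HasSuperDeriv.add hr hs
    rwa [add_zero] at h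
  algebraMap_mem' z := by
    have h := hasSuperDeriv_const (i := i) (τ := τ) (x := x) (algebraMap ℂ EvenGrassmann z)
      (g := g)
    rwa [oddDeriv_val_algebraMap] at h

lemma intervalDet_mem_superKernel {j k : Fin 3}
    (h : ∀ μ, evenInterval j k μ ∈ superKernel g i τ x) :
    intervalDet j k ∈ superKernel g i τ x := by
  have heq : intervalDet j k = ∑ μ, minkowski μ • (evenInterval j k μ * evenInterval j k μ) := by
    ext1 y
    rw [intervalDet_eq_sum, Finset.sum_apply]
    rfl
  rw [heq]
  exact sum_mem fun μ _ => Subalgebra.smul_mem _ (mul_mem (h μ) (h μ)) _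

end SuperDerivative

section CovariantDerivatives

lemma covD_eq_superDeriv (i : Fin 3) (a : Fin 2) (Φ : Superfield) (x : Config) :
    covD i a Φ x = superDeriv (Sum.inl (i, a)) i
      (fun μ => -(Complex.I • ∑ b, pauli μ a b • θbar i b)) Φ x := by
  simp only [covD, superDeriv, Finset.sum_mul, Finset.smul_sum, neg_mul, smul_mul_assoc,
    Finset.sum_neg_distrib, sub_eq_add_neg]

lemma covDbar_eq_neg_superDeriv (i : Fin 3) (b : Fin 2) (Φ : Superfield) (x : Config) :
    covDbar i b Φ x = -superDeriv (Sum.inr (i, b)) i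
      (fun μ => -(Complex.I • ∑ a, pauli μ a b • θ i a)) Φ x := by
  simp only [covDbar, superDeriv, Finset.sum_mul, Finset.smul_sum, neg_mul, smul_mul_assoc,
    Finset.sum_neg_distrib, neg_add, neg_neg]

variable {x : Config}

/-- The coordinate difference `x_i^μ - x_j^μ` as a linear function. -/
def coordinateDifference (i j : Fin 3) (μ : Fin 4) : Config →L[ℝ] ℂ :=
  Complex.ofRealCLM.comp ((ContinuousLinearMap.proj (R := ℝ) (φ := fun _ : Fin 4 => ℝ) μ).comp
    (ContinuousLinearMap.proj (R := ℝ) (φ := fun _ : Fin 3 => Fin 4 → ℝ) i -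
      ContinuousLinearMap.proj (R := ℝ) (φ := fun _ : Fin 3 => Fin 4 → ℝ) j))

lemma sum_coordinateDifference_single_smul {S : Type*} [AddCommGroup S] [Module ℂ S]
    (i j k : Fin 3) (μ : Fin 4) (τ : Fin 4 → S) :
    ∑ ν, coordinateDifference i j μ (Pi.single k (Pi.single ν 1)) • τ ν =
      ((Pi.single k 1 : Fin 3 → ℂ) i - (Pi.single k 1 : Fin 3 → ℂ) j) • τ μ := by
  have h : ∀ ν, coordinateDifference i j μ (Pi.single k (Pi.single ν 1)) =
      (Pi.single ν ((Pi.single k 1 : Fin 3 → ℂ) i - (Pi.single k 1 : Fin 3 → ℂ) j) :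
        Fin 4 → ℂ) μ := fun ν => by
    change (((Pi.single k (Pi.single ν 1) : Config) i μ -
      (Pi.single k (Pi.single ν 1) : Config) j μ : ℝ) : ℂ) = _
    by_cases hi : i = k <;> by_cases hj : j = k <;> by_cases hν : μ = ν <;>
      simp [hi, hj, hν]
  simp only [h]
  rw [Finset.sum_eq_single_of_mem μ (Finset.mem_univ μ), Pi.single_eq_same]
  intro ν _ hν
  rw [Pi.single_eq_of_ne hν.symm, zero_smul]

lemma evenInterval_mem_superKernel {g : Gen} {i j k : Fin 3} {τ : Fin 4 → Grassmann} {μ : Fin 4}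
    (h : ((Pi.single k 1 : Fin 3 → ℂ) i - (Pi.single k 1 : Fin 3 → ℂ) j) • τ μ +
      oddDeriv g (val (Complex.I • ∑ a, ∑ b, pauli μ a b •
        (pair i a i b + pair j a j b - (2 : ℂ) • pair j a i b))) = 0) :
    evenInterval i j μ ∈ superKernel g k τ x := by
  rw [← sum_coordinateDifference_single_smul] at h
  have hd := (hasSuperDeriv_algebraMap (g := g) (i := k) (τ := τ) (x := x)
    (coordinateDifference i j μ).hasFDerivAt).add (hasSuperDeriv_const
      (Complex.I • ∑ a, ∑ b, pauli μ a b • (pair i a i b + pair j a j b - (2 : ℂ) • pair j a i b)))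
  rwa [h] at hd

lemma oddDeriv_θ_pair (p : Fin 3 × Fin 2) (j : Fin 3) (a : Fin 2) (i : Fin 3) (b : Fin 2) :
    oddDeriv (Sum.inl p) (val (pair j a i b)) = if (j, a) = p then θbar i b else 0 := by
  rw [pair, oddDeriv_val_ofVectors]
  simp [θbar, Pi.single_apply, eq_comm]

lemma oddDeriv_θbar_pair (p : Fin 3 × Fin 2) (j : Fin 3) (a : Fin 2) (i : Fin 3) (b : Fin 2) :
    oddDeriv (Sum.inr p) (val (pair j a i b)) = -if (i, b) = p then θ j a else 0 := by
  rw [pair, oddDeriv_val_ofVectors]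
  simp [θ, Pi.single_apply, eq_comm]

lemma evenInterval_mem_superKernel_antichiral {j : Fin 3} (hj : j ≠ 0) (s : Fin 2) (μ : Fin 4) :
    evenInterval 0 j μ ∈ superKernel (Sum.inl (0, s)) 0
      (fun μ => -(Complex.I • ∑ b, pauli μ s b • θbar 0 b)) x := by
  refine evenInterval_mem_superKernel ?_
  simp only [map_smul, map_sum, map_add, map_sub, oddDeriv_θ_pair]
  fin_cases s <;> simp [hj, Fin.sum_univ_two]

lemma evenInterval_mem_superKernel_chiral {i j : Fin 3} (hi : i ≠ 0) (s : Fin 2) (μ : Fin 4) :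
    evenInterval 0 j μ ∈ superKernel (Sum.inr (i, s)) i
      (fun μ => -(Complex.I • ∑ a, pauli μ a s • θ i a)) x := by
  refine evenInterval_mem_superKernel ?_
  simp only [map_smul, map_sum, map_add, map_sub, oddDeriv_θbar_pair]
  rcases eq_or_ne j i with rfl | hij
  · fin_cases s <;> simp [hi.symm, Fin.sum_univ_two] <;> abel
  · fin_cases s <;> simp [hi.symm, hij, Fin.sum_univ_two]

end CovariantDerivatives

section Sufficiency

lemma differentiable_bodySq (i j : Fin 3) : Differentiable ℝ (bodySq i j) := by
  have : ∀ μ : Fin 4, Differentiable ℝ fun y : Config => ((y i μ - y j μ : ℝ) : ℂ) := fun μ =>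
    (coordinateDifference i j μ).differentiable
  unfold bodySq
  fun_prop

variable {U : Set Config} {ℓ : Fin 3 → Fin 3 → Config → ℂ} (hU : IsOpen U)
  (hℓ : IsLogBranch U ℓ)
include hU hℓ

/-- A continuous branch differs from the principal logarithm of a ratio by a constant, locally. -/
lemma differentiableAt_log_branch {i j : Fin 3} (hij : i ≠ j) {x : Config} (hx : x ∈ U) :
    DifferentiableAt ℝ (ℓ i j) x := by
  have hne : bodySq i j x ≠ 0 := hℓ.exp_eq i j hij x hx ▸ Complex.exp_ne_zero _
  have hcont : ContinuousAt (ℓ i j) x := (hℓ.continuousOn i j hij).continuousAt (hU.mem_nhds hx)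
  have him : ∀ᶠ y in nhds x, |(ℓ i j y - ℓ i j x).im| < Real.pi := by
    refine ContinuousAt.eventually_lt (by fun_prop) continuousAt_const ?_
    rw [sub_self, Complex.zero_im, abs_zero]
    exact Real.pi_pos
  have heq : ℓ i j =ᶠ[nhds x] fun y => ℓ i j x + Complex.log (bodySq i j y / bodySq i j x) := by
    filter_upwards [him, hU.mem_nhds hx] with y hy hyU
    rw [← hℓ.exp_eq i j hij x hx, ← hℓ.exp_eq i j hij y hyU, ← Complex.exp_sub,
      Complex.log_exp (abs_lt.1 hy).1 (abs_lt.1 hy).2.le, add_sub_cancel]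
  refine DifferentiableAt.congr_of_eventuallyEq (DifferentiableAt.const_add _ ?_) heq
  have hlog : DifferentiableAt ℝ Complex.log (bodySq i j x / bodySq i j x) :=
    (Complex.differentiableAt_log
      (by rw [div_self hne]; exact Complex.one_mem_slitPlane)).restrictScalars ℝ
  exact hlog.comp x ((differentiable_bodySq i j x).mul_const _)

variable {G : Superfield} {C : ℂ} {η : Fin 3 → ℝ}
  (hG : ∀ x ∈ U, G x = C • chiralThreePoint ℓ η x)
include hG

lemma superDeriv_eq_zero_of_eq_smul_chiralThreePoint {g : Gen} {i : Fin 3}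
    {τ : Fin 4 → Grassmann} {x : Config} (hx : x ∈ U)
    (h : ∀ j, j ≠ 0 → ∀ μ, evenInterval 0 j μ ∈ superKernel g i τ x) :
    superDeriv g i τ G x = 0 := by
  have hpow : ∀ j, j ≠ 0 → ∀ a : ℂ,
      (fun y => complexPow 13 (ℓ 0 j y) a (intervalDet 0 j y)) ∈ superKernel g i τ x :=
    fun j hj a => (intervalDet_mem_superKernel (h j hj)).complexPow
      (differentiableAt_log_branch hU hℓ hj.symm hx)
      (pow_eq_zero_of_le (by decide) (pow_seven_eq_zero
        (hasLog_intervalDet (hℓ.exp_eq 0 j hj.symm x hx)))) a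
  have hmem := Subalgebra.smul_mem _
    (mul_mem (hpow 1 (by decide) (-η 1 : ℂ)) (hpow 2 (by decide) (-η 2 : ℂ))) C
  refine (superDeriv_congr ?_).trans hmem.eq
  filter_upwards [hU.mem_nhds hx] with y hy
  have hL := hℓ.isLogAt hy
  rw [hG y hy, chiralThreePoint_eq hL, neg_add, Matrix.single_neg, Matrix.single_neg,
    hL.intervalMonomial_add, intervalMonomial_single (by decide),
    intervalMonomial_single (by decide), ← map_smul]
  rfl

lemma isChiralOn_of_eq_smul_chiralThreePoint : IsChiralOn U G := by
  have hcovDbar : ∀ x ∈ U, ∀ i, i ≠ 0 → ∀ s, covDbar i s G x = 0 := fun x hx i hi s => by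
    rw [covDbar_eq_neg_superDeriv, neg_eq_zero]
    exact superDeriv_eq_zero_of_eq_smul_chiralThreePoint hU hℓ hG hx
      fun _ _ μ => evenInterval_mem_superKernel_chiral hi s μ
  refine fun x hx s => ⟨?_, hcovDbar x hx 1 (by decide) s, hcovDbar x hx 2 (by decide) s⟩
  rw [covD_eq_superDeriv]
  exact superDeriv_eq_zero_of_eq_smul_chiralThreePoint hU hℓ hG hx
    fun _ hj μ => evenInterval_mem_superKernel_antichiral hj s μ

end Sufficiency

end ThreePointSCFT

end

open ThreePointSCFT in
theorem mainTheorem4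
    (U : Set Config) (hUo : IsOpen U) (hUne : U.Nonempty)
    (ℓ : Fin 3 → Fin 3 → Config → ℂ) (hℓ : IsLogBranch U ℓ)
    (η κ : Fin 3 → ℝ) (hκ : ∑ i, κ i = 0) (f : PowerSeries ℂ) :
    (ChiralCharges η κ → η 0 = η 1 + η 2) ∧
    (IsChiralOn U (generalThreePoint ℓ η κ f) ↔
      ∃ C : ℂ,
        (∀ x ∈ U, taylorEval f (I3PF x) = C • gpow 0 (-Δ η κ 1 0) (I3PF x + 1)) ∧
        (∀ x ∈ U, generalThreePoint ℓ η κ f x = C • chiralThreePoint ℓ η x) ∧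
        (C ≠ 0 → ChiralCharges η κ)) := by
  refine ⟨fun h => h.eta_eq hκ, fun h => ?_,
    fun ⟨C, _, hG, _⟩ => isChiralOn_of_eq_smul_chiralThreePoint hUo hℓ hG⟩
  obtain ⟨x₀, hx₀⟩ := hUne
  have hf : ∀ x ∈ U, taylorEval f (I3PF x) =
      f.coeff 0 • gpow 0 (-Δ η κ 1 0) (I3PF x + 1) := fun x hx =>
    taylorEval_I3PF_of_covD (hℓ.isLogAt hx) fun s => (h x hx s).1
  have hC : f.coeff 0 ≠ 0 → ChiralCharges η κ := fun h₀ =>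
    chiralCharges_of_coeff_zero_ne_zero (hℓ.isLogAt hx₀) (fun s => (h x₀ hx₀ s).1) hκ h₀
      (h x₀ hx₀ 0).2.1 (h x₀ hx₀ 0).2.2
  exact ⟨f.coeff 0, hf, fun x hx =>
    generalThreePoint_eq_smul_chiralThreePoint (hℓ.isLogAt hx) (hf x hx) hκ hC, hC⟩
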